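/- For each $n$ let $U_n$ be an $n\times n$ standard unitary random matrix (its law is the Haar probability measure on the unitary group $\mathcal U(n)$) and let $R_n$ be an $n\times n$ complex random matrix independent of $U_n$, all defined on one probability space. Write $\mathrm{tr}_n=\frac1n\mathrm{Tr}$. Let $\rho$ be a compactly supported probability measure on $\mathbb R$ such that, almost surely, $R_nR_n^*$ converges in distribution to $\rho$, in the sense that for every $k\ge 0$ the $k$-th moment of the empirical eigenvalue distribution of $R_nR_n^*$ converges to the $k$-th moment of $\rho$. Then the following hold. 1. Almost surely, for all $l\ge 1$ and all nonzero integers $m_1,\dots,m_l$, $$\left|\mathrm{tr}_n\bigl(U_n^{m_1}P_1(R_n)U_n^{m_2}P_2(R_n)\cdots U_n^{m_l}P_l(R_n)\bigr)\right|\longrightarrow 0\qquad(n\to\infty),$$ uniformly over all complex polynomials $P_1,\dots,P_l$ (which may depend on $n$ and on the realization) with degrees at most $d$, with coefficients of modulus at most $C$, and with $\mathrm{tr}_n(P_i(R_n))=0$ for $1\le i\le l$, for every choice of $d$ and $C$. 2. The same holds, with $P_i(R_n)$ replaced by $P_i(R_n,R_n^*)$, for polynomials $P_i$ in two noncommuting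 variables. 3. A family of $n\times n$ random matrices is said to have a limit distribution almost everywhere if there is a deterministic linear functional $\varphi$ on the noncommutative polynomials in the corresponding variables such that, almost surely, $\mathrm{tr}_n$ of every noncommutative polynomial in the family converges to the value of $\varphi$ at that polynomial. Two families are asymptotically free almost everywhere if together they have a limit distribution $\varphi$ almost everywhere, and the unital algebras generated by the variables of the first family and by those of the second are free with respect to $\varphi$. If $R_n$ has a limit distribution almost everywhere, then $\{U_n,U_n^*\}$ and $\{R_n\}$ are asymptotically free almost everywhere. If $\{R_n,R_n^*\}$ has a limit distribution almost everywhere, then $\{U_n,U_n^*\}$ and $\{R_n,R_n^*\}$ are asymptotically free almost everywhere. -/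

import Mathlib

open MeasureTheory ProbabilityTheory Filter Topology
open scoped Matrix

namespace RandomMatrix

/-- The σ-algebra on complex matrices generated by the entries (the product σ-algebra). -/
noncomputable instance instMeasurableSpaceMatrix {m n : Type*} : MeasurableSpace (Matrix m n ℂ) :=
  inferInstanceAs (MeasurableSpace (m → n → ℂ))

/-- The normalized trace `tr_n` on `n × n` matrices. -/
noncomputable def tr {n : ℕ} (A : Matrix (Fin n) (Fin n) ℂ) : ℂ :=
  A.trace / (n : ℂ)

/-- A unitary random matrix is standard unitary if its distribution is the Haar probability
measure on the unitary group. -/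
def IsStandardUnitary {Ω : Type*} [MeasurableSpace Ω] (μ : Measure Ω) {n : ℕ}
    (U : Ω → Matrix.unitaryGroup (Fin n) ℂ) : Prop :=
  Measurable U ∧ IsProbabilityMeasure (μ.map U) ∧ (μ.map U).IsHaarMeasure

/-- The empirical eigenvalue distribution `(1/n) (δ(λ₁) + ⋯ + δ(λₙ))` of a Hermitian matrix. -/
noncomputable def empiricalEigenvalueDistribution {n : ℕ} {A : Matrix (Fin n) (Fin n) ℂ}
    (hA : A.IsHermitian) : Measure ℝ :=
  ((n : ENNReal)⁻¹) • ∑ i : Fin n, Measure.dirac (hA.eigenvalues i)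

/-- Convergence in distribution: the moments converge to the moments of the limit. -/
def ConvergesInDistribution (ν : ℕ → Measure ℝ) (ρ : Measure ℝ) : Prop :=
  ∀ k : ℕ, Tendsto (fun n => ∫ x, x ^ k ∂(ν n)) atTop (𝓝 (∫ x, x ^ k ∂ρ))

/-- The pair `(A, A*)`, as a family indexed by `Bool`; `true` stands for the adjoint. -/
def withAdjoint {n : ℕ} (A : Matrix (Fin n) (Fin n) ℂ) (b : Bool) : Matrix (Fin n) (Fin n) ℂ :=
  if b then Aᴴ else A

/-- Polynomials in two noncommuting variables, that stand for a matrix and its adjoint. -/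
abbrev StarPolynomial : Type := FreeAlgebra ℂ Bool

/-- The coefficient of a noncommutative polynomial at a word. -/
noncomputable def StarPolynomial.coeff (P : StarPolynomial) (w : FreeMonoid Bool) : ℂ :=
  (FreeAlgebra.equivMonoidAlgebraFreeMonoid P).coeff w

/-- The value `P(A, A*)`. -/
noncomputable def StarPolynomial.eval {n : ℕ} (P : StarPolynomial)
    (A : Matrix (Fin n) (Fin n) ℂ) : Matrix (Fin n) (Fin n) ℂ :=
  FreeAlgebra.lift ℂ (withAdjoint A) P

/-- The product `U^{m₁} D₁ U^{m₂} D₂ ⋯ U^{mₗ} Dₗ`, in this order. -/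
noncomputable def alternatingProduct {n l : ℕ} (U : Matrix.unitaryGroup (Fin n) ℂ)
    (m : Fin l → ℤ) (D : Fin l → Matrix (Fin n) (Fin n) ℂ) : Matrix (Fin n) (Fin n) ℂ :=
  (List.ofFn fun i => ((U ^ m i : Matrix.unitaryGroup (Fin n) ℂ) :
    Matrix (Fin n) (Fin n) ℂ) * D i).prod

/-- The family `(X n j)_j` of `n × n` random matrices has the (deterministic) limit distribution
`φ` almost everywhere: almost surely, as `n → ∞`, the normalized trace of every noncommutative
polynomial in the family converges to the value of `φ`. -/
def HasLimitDistribution {Ω : Type*} [MeasurableSpace Ω] (μ : Measure Ω) {J : Type*}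
    (X : (n : ℕ) → J → Ω → Matrix (Fin n) (Fin n) ℂ) (φ : FreeAlgebra ℂ J →ₗ[ℂ] ℂ) : Prop :=
  ∀ᵐ ω ∂μ, ∀ p : FreeAlgebra ℂ J,
    Tendsto (fun n => tr (FreeAlgebra.lift ℂ (fun j => X n j ω) p)) atTop (𝓝 (φ p))

/-- Freeness of a family of unital subalgebras: products of centered elements from consecutively
distinct subalgebras are centered. -/
def IsFreeFamily {A : Type*} [Ring A] [Algebra ℂ A] (φ : A →ₗ[ℂ] ℂ) {I : Type*}
    (S : I → Subalgebra ℂ A) : Prop :=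
  ∀ (l : ℕ) (i : Fin (l + 1) → I) (a : Fin (l + 1) → A),
    (∀ k, a k ∈ S (i k)) → (∀ k : Fin l, i k.castSucc ≠ i k.succ) → (∀ k, φ (a k) = 0) →
    φ (List.ofFn a).prod = 0

/-- Two families of `n × n` random matrices are asymptotically free almost everywhere if jointly
they have a limit distribution almost everywhere, with respect to which the unital subalgebras
generated by the variables of the first and by those of the second family are free. -/
def AsymptoticallyFree {Ω : Type*} [MeasurableSpace Ω] (μ : Measure Ω) {J K : Type*}
    (X : (n : ℕ) → J → Ω → Matrix (Fin n) (Fin n) ℂ)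
    (Y : (n : ℕ) → K → Ω → Matrix (Fin n) (Fin n) ℂ) : Prop :=
  ∃ φ : FreeAlgebra ℂ (J ⊕ K) →ₗ[ℂ] ℂ,
    HasLimitDistribution μ (fun n => Sum.elim (X n) (Y n)) φ ∧
    IsFreeFamily φ (fun b : Bool => Algebra.adjoin ℂ
      (if b then Set.range (fun k : K => FreeAlgebra.ι ℂ (Sum.inr k : J ⊕ K))
        else Set.range (fun j : J => FreeAlgebra.ι ℂ (Sum.inl j : J ⊕ K))))

end RandomMatrix

open RandomMatrix

/-! The core is a second moment bound, `integral_norm_tr_word_sq_le`. Take a word in letters `U D`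
and `U* D`, with fixed matrices `D` that have trace zero wherever the exponent changes sign. Under
Haar measure the mean square of its normalized trace is `O(1/n²)`, with a constant depending only on
the length and on bounds for traces of products. The proof is by induction on length through a
Schwinger-Dyson equation. Invariance under `U ↦ exp(tX) U` makes the integral of the derivative of
`tr (A w) * conj (tr w)` vanish, and summing over matrix units gives `integral_loopSum`. Cutting at
the first letter produces `n |tr w|²`. Every other cut contains the trace of an initial piece, which
after cyclic reduction is zero or the trace of a shorter reduced word. What remains is of order
`1/n`.

The hypothesis controls moments of `R R*` and no operator norm, so traces of products are bounded by
Hölder's inequality for Schatten norms of exponent `2 ^ (k + 1)` (`schattenPow_mul_sq_le`).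

By independence the bound holds conditionally on `R`, after truncation to bounded moments. Since `∑
1/n²` converges, the traces tend to zero almost surely. Words with centering marks (signatures) are
countable, so one null set serves all of them. Uniformity is multilinearity: with bounded degree and
coefficients, a trace is a bounded combination of finitely many signature traces, and a polynomial
of trace zero is the same combination of centered words (`norm_tr_mul_word_le`).

For freeness, polynomials in `U`, `U*` and `R` (or `R`, `R*`) are rewritten as combinations of
centered words preceded by a polynomial in `R`, which gives the joint limit. An alternating product
of centered elements is a combination of centered words, possibly preceded by a centered polynomial,
so its limit is zero. -/

namespace RandomMatrix

/-! ### The normalized trace and its Cauchy-Schwarz inequality -/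

section Trace

variable {n : ℕ}

lemma tr_zero : tr (0 : Matrix (Fin n) (Fin n) ℂ) = 0 := by simp [tr]

lemma tr_add (A B : Matrix (Fin n) (Fin n) ℂ) : tr (A + B) = tr A + tr B := by
  simp [tr, Matrix.trace_add, add_div]

lemma tr_sub (A B : Matrix (Fin n) (Fin n) ℂ) : tr (A - B) = tr A - tr B := by
  simp [tr, Matrix.trace_sub, sub_div]

lemma tr_smul (c : ℂ) (A : Matrix (Fin n) (Fin n) ℂ) : tr (c • A) = c * tr A := by
  simp [tr, Matrix.trace_smul, mul_div_assoc]

lemma tr_sum {ι : Type*} (s : Finset ι) (A : ι → Matrix (Fin n) (Fin n) ℂ) :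
    tr (∑ i ∈ s, A i) = ∑ i ∈ s, tr (A i) := by
  simp [tr, Matrix.trace_sum, Finset.sum_div]

lemma tr_mul_comm (A B : Matrix (Fin n) (Fin n) ℂ) : tr (A * B) = tr (B * A) := by
  simp [tr, Matrix.trace_mul_comm A B]

lemma tr_one (hn : n ≠ 0) : tr (1 : Matrix (Fin n) (Fin n) ℂ) = 1 := by
  have : (n : ℂ) ≠ 0 := by exact_mod_cast hn
  simp [tr, this]

lemma norm_tr_one_le : ‖tr (1 : Matrix (Fin n) (Fin n) ℂ)‖ ≤ 1 := by
  rcases eq_or_ne n 0 with rfl | hn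
  · simp [tr]
  · simp [tr_one hn]

lemma natCast_mul_tr (A : Matrix (Fin n) (Fin n) ℂ) : (n : ℂ) * tr A = A.trace := by
  rcases eq_or_ne n 0 with rfl | hn
  · simp [Matrix.trace]
  · have : (n : ℂ) ≠ 0 := by exact_mod_cast hn
    simp [tr]; field_simp

lemma tr_mul_pow_comm (A B : Matrix (Fin n) (Fin n) ℂ) (m : ℕ) :
    tr ((A * B) ^ m) = tr ((B * A) ^ m) := by
  cases m with
  | zero => simp
  | succ m =>
    have h : SemiconjBy B (A * B) (B * A) := by simp [SemiconjBy, mul_assoc]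
    rw [pow_succ, ← mul_assoc, tr_mul_comm, ← mul_assoc, (h.pow_right m).eq,
      mul_assoc, ← pow_succ]

lemma re_tr_mul_conjTranspose (A : Matrix (Fin n) (Fin n) ℂ) :
    (tr (A * Aᴴ)).re = (∑ p : Fin n × Fin n, ‖A p.1 p.2‖ ^ 2) / n := by
  have : (A * Aᴴ).trace = ((∑ p : Fin n × Fin n, ‖A p.1 p.2‖ ^ 2 : ℝ) : ℂ) := by
    simp only [Matrix.trace, Matrix.diag, Matrix.mul_apply, Matrix.conjTranspose_apply,
      Fintype.sum_prod_type]
    push_cast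
    refine Finset.sum_congr rfl fun i _ => Finset.sum_congr rfl fun j _ => ?_
    simpa using Complex.mul_conj' (A i j)
  rw [tr, this, ← Complex.ofReal_natCast, ← Complex.ofReal_div, Complex.ofReal_re]

/-- The Cauchy-Schwarz inequality for the normalized trace. -/
lemma norm_tr_mul_sq_le (A B : Matrix (Fin n) (Fin n) ℂ) :
    ‖tr (A * B)‖ ^ 2 ≤ (tr (A * Aᴴ)).re * (tr (B * Bᴴ)).re := by
  have h1 : ‖(A * B).trace‖ ≤ ∑ p : Fin n × Fin n, ‖A p.1 p.2‖ * ‖B p.2 p.1‖ := by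
    simp only [Matrix.trace, Matrix.diag, Matrix.mul_apply, Fintype.sum_prod_type]
    refine (norm_sum_le _ _).trans (Finset.sum_le_sum fun i _ => (norm_sum_le _ _).trans ?_)
    simp
  have h2 := Finset.sum_mul_sq_le_sq_mul_sq Finset.univ (fun p : Fin n × Fin n => ‖A p.1 p.2‖)
    (fun p => ‖B p.2 p.1‖)
  have h3 : ∑ p : Fin n × Fin n, ‖B p.2 p.1‖ ^ 2 = ∑ p : Fin n × Fin n, ‖B p.1 p.2‖ ^ 2 :=
    Fintype.sum_equiv (Equiv.prodComm _ _) _ _ fun p => rfl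
  rw [re_tr_mul_conjTranspose, re_tr_mul_conjTranspose, tr, norm_div, Complex.norm_natCast,
    div_pow, div_mul_div_comm, ← sq (n : ℝ)]
  gcongr
  rw [h3] at h2
  exact (pow_le_pow_left₀ (norm_nonneg _) h1 2).trans h2

end Trace

/-! ### Hölder's inequality for Schatten norms with dyadic exponents -/

section Schatten

variable {n : ℕ}

/-- The normalized trace of `(A A*) ^ 2 ^ k`, that is, the `2 ^ (k + 1)`-th power of the
normalized Schatten norm of that exponent. -/
noncomputable def schattenPow (k : ℕ) (A : Matrix (Fin n) (Fin n) ℂ) : ℝ :=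
  (tr ((A * Aᴴ) ^ 2 ^ k)).re

open scoped ComplexOrder in
lemma schattenPow_nonneg (k : ℕ) (A : Matrix (Fin n) (Fin n) ℂ) : 0 ≤ schattenPow k A := by
  have h := ((Matrix.posSemidef_self_mul_conjTranspose A).pow (2 ^ k)).trace_nonneg
  rw [schattenPow, tr, Complex.div_natCast_re]
  exact div_nonneg (Complex.nonneg_iff.1 h).1 (Nat.cast_nonneg _)

lemma schattenPow_conjTranspose (k : ℕ) (A : Matrix (Fin n) (Fin n) ℂ) :
    schattenPow k Aᴴ = schattenPow k A := by
  rw [schattenPow, schattenPow, Matrix.conjTranspose_conjTranspose, tr_mul_pow_comm]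

lemma schattenPow_le_one_of_mem_unitaryGroup (k : ℕ) {A : Matrix (Fin n) (Fin n) ℂ}
    (hA : A ∈ Matrix.unitaryGroup (Fin n) ℂ) : schattenPow k A ≤ 1 := by
  have : A * Aᴴ = 1 := Matrix.mem_unitaryGroup_iff.1 hA
  rw [schattenPow, this, one_pow]
  exact (Complex.re_le_norm _).trans norm_tr_one_le

/-- Hölder with both factors equal says that squaring the matrix costs one step in the exponent;
this is iterated `i` times. Hölder is assumed only below `k`, so that the lemma can be used inside
the induction that proves it. -/
lemma schattenPow_pow_le {k : ℕ}
    (H : ∀ j < k, ∀ A B : Matrix (Fin n) (Fin n) ℂ,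
      schattenPow j (A * B) ^ 2 ≤ schattenPow (j + 1) A * schattenPow (j + 1) B)
    (Z : Matrix (Fin n) (Fin n) ℂ) (i : ℕ) :
    ∀ j, j + i ≤ k → schattenPow j (Z ^ 2 ^ i) ≤ schattenPow (j + i) Z := by
  induction i with
  | zero => intro j _; simp
  | succ i ih =>
    intro j hj
    have h := H j (by omega) (Z ^ 2 ^ i) (Z ^ 2 ^ i)
    rw [← pow_add, ← two_mul, ← pow_succ', ← sq] at h
    refine (abs_le_of_sq_le_sq' h (schattenPow_nonneg _ _)).2.trans ?_
    have := ih (j + 1) (by omega)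
    rwa [add_assoc, add_comm 1 i] at this

/-- This is Hölder's inequality in disguise, for `P = B B*` and `Q = A* A`. With `Z = P Q`,
Cauchy-Schwarz followed by lower Hölder inequalities replaces `Z ^ 2 ^ (k + 1)` by `(Z Z*) ^ 2 ^ k`.
By cyclicity this has the trace of `(Q² P²) ^ 2 ^ k`, to which the induction hypothesis applies. -/
lemma norm_tr_pow_sq_le (k : ℕ) : ∀ P Q : Matrix (Fin n) (Fin n) ℂ, P.IsHermitian → Q.IsHermitian →
    ‖tr ((P * Q) ^ 2 ^ k)‖ ^ 2 ≤ (tr (P ^ 2 ^ (k + 1))).re * (tr (Q ^ 2 ^ (k + 1))).re := by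
  induction k using Nat.strong_induction_on with
  | _ k ih =>
  have H : ∀ j < k, ∀ A B : Matrix (Fin n) (Fin n) ℂ,
      schattenPow j (A * B) ^ 2 ≤ schattenPow (j + 1) A * schattenPow (j + 1) B := by
    intro j hj A B
    have h := ih j hj (B * Bᴴ) (Aᴴ * A) (Matrix.isHermitian_mul_conjTranspose_self B)
      (Matrix.isHermitian_conjTranspose_mul_self A)
    have e : tr ((A * B * (A * B)ᴴ) ^ 2 ^ j) = tr ((B * Bᴴ * (Aᴴ * A)) ^ 2 ^ j) := by
      rw [Matrix.conjTranspose_mul, mul_assoc, tr_mul_pow_comm]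
      simp only [mul_assoc]
    rw [tr_mul_pow_comm Aᴴ A] at h
    calc schattenPow j (A * B) ^ 2 ≤ ‖tr ((B * Bᴴ * (Aᴴ * A)) ^ 2 ^ j)‖ ^ 2 := by
          rw [schattenPow, e, ← sq_abs]
          exact pow_le_pow_left₀ (abs_nonneg _) (Complex.abs_re_le_norm _) 2
      _ ≤ _ := by rw [mul_comm] at h; exact h
  intro P Q hP hQ
  rcases k with _ | k
  · simpa [sq, hP.eq, hQ.eq] using norm_tr_mul_sq_le P Q
  have h1 := norm_tr_mul_sq_le ((P * Q) ^ 2 ^ k) ((P * Q) ^ 2 ^ k)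
  rw [← pow_add, ← two_mul, ← pow_succ', ← sq] at h1
  have h2 : schattenPow 0 ((P * Q) ^ 2 ^ k) ≤ schattenPow k (P * Q) := by
    simpa using schattenPow_pow_le (k := k) (fun j hj => H j (by omega)) (P * Q) k 0 (by omega)
  have h3 : schattenPow 0 ((P * Q) ^ 2 ^ k)
      = (tr ((P * Q) ^ 2 ^ k * ((P * Q) ^ 2 ^ k)ᴴ)).re := by simp [schattenPow]
  rw [← h3] at h1
  refine h1.trans ((pow_le_pow_left₀ (schattenPow_nonneg _ _) h2 2).trans ?_)
  have h4 := ih k (by omega) (Q ^ 2) (P ^ 2) (hQ.pow 2) (hP.pow 2)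
  have e : tr ((P * Q * (P * Q)ᴴ) ^ 2 ^ k) = tr ((Q ^ 2 * P ^ 2) ^ 2 ^ k) := by
    rw [Matrix.conjTranspose_mul, hP.eq, hQ.eq, mul_assoc, tr_mul_pow_comm]
    simp only [mul_assoc, sq]
  rw [← pow_mul, ← pow_mul, ← pow_succ', mul_comm (Complex.re _)] at h4
  refine le_trans ?_ h4
  rw [schattenPow, e, ← sq_abs]
  exact pow_le_pow_left₀ (abs_nonneg _) (Complex.abs_re_le_norm _) 2

/-- Hölder's inequality for Schatten norms whose exponent is a power of two. -/
lemma schattenPow_mul_sq_le (k : ℕ) (A B : Matrix (Fin n) (Fin n) ℂ) :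
    schattenPow k (A * B) ^ 2 ≤ schattenPow (k + 1) A * schattenPow (k + 1) B := by
  have h := norm_tr_pow_sq_le k (B * Bᴴ) (Aᴴ * A) (Matrix.isHermitian_mul_conjTranspose_self B)
    (Matrix.isHermitian_conjTranspose_mul_self A)
  have e : tr ((A * B * (A * B)ᴴ) ^ 2 ^ k) = tr ((B * Bᴴ * (Aᴴ * A)) ^ 2 ^ k) := by
    rw [Matrix.conjTranspose_mul, mul_assoc, tr_mul_pow_comm]
    simp only [mul_assoc]
  rw [tr_mul_pow_comm Aᴴ A, mul_comm (Complex.re _)] at h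
  refine le_trans ?_ h
  rw [schattenPow, e, ← sq_abs]
  exact pow_le_pow_left₀ (abs_nonneg _) (Complex.abs_re_le_norm _) 2

/-- Splitting off one factor raises the exponent index of the remaining product by one, so a list of
length `r` needs indices up to `k + r`. The common bound `b` reproduces itself because `b * b = b ^
2`. -/
lemma schattenPow_listProd_le {b : ℝ} (hb : 1 ≤ b) {m : ℕ} (l : List (Matrix (Fin n) (Fin n) ℂ)) :
    ∀ k, k + l.length ≤ m → (∀ A ∈ l, ∀ k ≤ m, schattenPow k A ≤ b) →
      schattenPow k l.prod ≤ b := by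
  induction l with
  | nil =>
    intro k _ _
    exact (schattenPow_le_one_of_mem_unitaryGroup k (one_mem _)).trans hb
  | cons A l ih =>
    intro k hk h
    simp only [List.length_cons] at hk
    rw [List.prod_cons]
    refine (abs_le_of_sq_le_sq' ((schattenPow_mul_sq_le k A l.prod).trans ?_) (by linarith)).2
    rw [sq]
    exact mul_le_mul (h A (by simp) _ (by omega))
      (ih (k + 1) (by omega) fun B hB => h B (by simp [hB]))
      (schattenPow_nonneg _ _) (by linarith)

/-- A set of matrices on which the normalized trace is bounded by `c` along all products with at
most `m` factors. -/
def TraceBounded (m : ℕ) (c : ℝ) (T : Set (Matrix (Fin n) (Fin n) ℂ)) : Prop :=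
  ∀ l : List (Matrix (Fin n) (Fin n) ℂ), l.length ≤ m → (∀ A ∈ l, A ∈ T) → ‖tr l.prod‖ ≤ c

lemma traceBounded_of_schattenPow_le {b : ℝ} (hb : 1 ≤ b) {m : ℕ}
    {T : Set (Matrix (Fin n) (Fin n) ℂ)} (h : ∀ A ∈ T, ∀ k ≤ m, schattenPow k A ≤ b) :
    TraceBounded m b T := by
  intro l hl hT
  have h1 := schattenPow_listProd_le hb l 0 (by omega) fun A hA => h A (hT A hA)
  have h2 := norm_tr_mul_sq_le l.prod 1
  have h3 : (tr (l.prod * (l.prod)ᴴ)).re ≤ b := by simpa [schattenPow] using h1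
  have h4 : (tr ((1 : Matrix (Fin n) (Fin n) ℂ) * 1ᴴ)).re ≤ 1 := by
    simpa using (Complex.re_le_norm _).trans (norm_tr_one_le (n := n))
  have h5 : 0 ≤ (tr ((1 : Matrix (Fin n) (Fin n) ℂ) * 1ᴴ)).re := by
    simpa [schattenPow] using schattenPow_nonneg 0 (1 : Matrix (Fin n) (Fin n) ℂ)
  rw [mul_one] at h2
  refine (abs_le_of_sq_le_sq' (h2.trans ?_) (by linarith)).2
  rw [sq]
  exact mul_le_mul h3 (h4.trans hb) h5 (by linarith)

end Schatten

/-! ### Stability of trace bounds under products and centering -/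

section TraceBounded

variable {n : ℕ}

/-- `A` is a product of at most `m` elements of `T`. -/
def IsProdOfLe (T : Set (Matrix (Fin n) (Fin n) ℂ)) (m : ℕ) (A : Matrix (Fin n) (Fin n) ℂ) :
    Prop :=
  ∃ l : List (Matrix (Fin n) (Fin n) ℂ), l.length ≤ m ∧ (∀ B ∈ l, B ∈ T) ∧ l.prod = A

variable {T : Set (Matrix (Fin n) (Fin n) ℂ)} {A B : Matrix (Fin n) (Fin n) ℂ} {m m' : ℕ} {c : ℝ}

lemma IsProdOfLe.one (m : ℕ) : IsProdOfLe T m 1 := ⟨[], by simp, by simp, by simp⟩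

lemma IsProdOfLe.of_mem (h : A ∈ T) : IsProdOfLe T 1 A := ⟨[A], by simp, by simpa, by simp⟩

lemma IsProdOfLe.mono (h : IsProdOfLe T m A) (hm : m ≤ m') : IsProdOfLe T m' A := by
  obtain ⟨l, h1, h2, h3⟩ := h
  exact ⟨l, h1.trans hm, h2, h3⟩

lemma IsProdOfLe.mul (h : IsProdOfLe T m A) (h' : IsProdOfLe T m' B) :
    IsProdOfLe T (m + m') (A * B) := by
  obtain ⟨l, h1, h2, rfl⟩ := h
  obtain ⟨l', h1', h2', rfl⟩ := h'
  refine ⟨l ++ l', by simp; omega, fun C hC => ?_, by simp⟩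
  rcases List.mem_append.1 hC with h | h
  exacts [h2 C h, h2' C h]

lemma IsProdOfLe.conjTranspose (hT : ∀ A ∈ T, Aᴴ ∈ T) (h : IsProdOfLe T m A) :
    IsProdOfLe T m Aᴴ := by
  obtain ⟨l, h1, h2, rfl⟩ := h
  refine ⟨(l.map Matrix.conjTranspose).reverse, by simpa, ?_, (Matrix.conjTranspose_list_prod l).symm⟩
  simpa using fun B hB => hT B (h2 B hB)

lemma IsProdOfLe.listProd {l : List (Matrix (Fin n) (Fin n) ℂ)} (h : ∀ B ∈ l, IsProdOfLe T m B) :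
    IsProdOfLe T (m * l.length) l.prod := by
  induction l with
  | nil => exact IsProdOfLe.one _
  | cons B l ih =>
    rw [List.prod_cons, List.length_cons, mul_add, mul_one, add_comm]
    exact (h B (by simp)).mul (ih fun C hC => h C (by simp [hC]))

lemma TraceBounded.norm_tr_le (hT : TraceBounded m c T) (h : IsProdOfLe T m A) : ‖tr A‖ ≤ c := by
  obtain ⟨l, h1, h2, rfl⟩ := h
  exact hT l h1 h2

lemma TraceBounded.mono (hT : TraceBounded m c T) (hm : m' ≤ m) : TraceBounded m' c T :=
  fun l hl h => hT l (hl.trans hm) h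

lemma TraceBounded.prodLe {d : ℕ} (hT : TraceBounded (d * m) c T) :
    TraceBounded m c {A | IsProdOfLe T d A} := fun _ hl h =>
  hT.norm_tr_le ((IsProdOfLe.listProd h).mono (Nat.mul_le_mul_left d hl))

/-- Expanding one factor `B - z` gives two products, one with `B` kept and one with weight at most
`c`, so each factor costs `1 + c`. -/
lemma TraceBounded.sub_smul_one (hc : 0 ≤ c) (hT : TraceBounded m c T) :
    TraceBounded m (c * (1 + c) ^ m)
      {A | ∃ B ∈ T, ∃ z : ℂ, ‖z‖ ≤ c ∧ A = B - z • (1 : Matrix (Fin n) (Fin n) ℂ)} := by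
  set S := {A | ∃ B ∈ T, ∃ z : ℂ, ‖z‖ ≤ c ∧ A = B - z • (1 : Matrix (Fin n) (Fin n) ℂ)} with hS
  -- The prefix `X` collects the factors `B` already chosen in the expansion.
  have key : ∀ l : List (Matrix (Fin n) (Fin n) ℂ), (∀ A ∈ l, A ∈ S) → ∀ (j : ℕ)
      (X : Matrix (Fin n) (Fin n) ℂ), IsProdOfLe T j X → j + l.length ≤ m →
      ‖tr (X * l.prod)‖ ≤ c * (1 + c) ^ l.length := by
    intro l
    induction l with
    | nil =>
      intro _ j X hX hj
      simpa using hT.norm_tr_le (hX.mono (by simpa using hj))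
    | cons A l ih =>
      intro h j X hX hj
      rw [List.length_cons] at hj ⊢
      obtain ⟨B, hB, z, hz, rfl⟩ := h A (by simp)
      have h' : ∀ A ∈ l, A ∈ S := fun A hA => h A (by simp [hA])
      have e : X * ((B - z • 1) :: l).prod = X * B * l.prod - z • (X * l.prod) := by
        simp [sub_mul, mul_sub, mul_assoc]
      have h1 := ih h' (j + 1) (X * B) (hX.mul (.of_mem hB)) (by omega)
      have h2 := ih h' j X hX (by omega)
      rw [e, tr_sub, tr_smul]
      calc ‖tr (X * B * l.prod) - z * tr (X * l.prod)‖
          ≤ ‖tr (X * B * l.prod)‖ + ‖z‖ * ‖tr (X * l.prod)‖ := by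
            rw [← norm_mul]; exact norm_sub_le _ _
        _ ≤ c * (1 + c) ^ l.length + c * (c * (1 + c) ^ l.length) := by gcongr
        _ = c * (1 + c) ^ (l.length + 1) := by ring
  intro l hl h
  have := key l h 0 1 (IsProdOfLe.one 0) (by omega)
  rw [one_mul] at this
  refine this.trans ?_
  gcongr
  linarith

end TraceBounded

/-! ### Words in a matrix and its adjoint, and their derivatives -/

section Word

variable {n : ℕ}

/-- The product of the matrices `U D` or `U* D` described by the list. -/
noncomputable def word (U : Matrix (Fin n) (Fin n) ℂ)
    (l : List (Bool × Matrix (Fin n) (Fin n) ℂ)) : Matrix (Fin n) (Fin n) ℂ :=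
  (l.map fun p => withAdjoint U p.1 * p.2).prod

@[simp] lemma word_nil (U : Matrix (Fin n) (Fin n) ℂ) : word U [] = 1 := rfl

@[simp] lemma word_cons (U : Matrix (Fin n) (Fin n) ℂ) (p : Bool × Matrix (Fin n) (Fin n) ℂ)
    (l : List (Bool × Matrix (Fin n) (Fin n) ℂ)) :
    word U (p :: l) = withAdjoint U p.1 * p.2 * word U l := by simp [word]

@[simp] lemma word_append (U : Matrix (Fin n) (Fin n) ℂ)
    (l l' : List (Bool × Matrix (Fin n) (Fin n) ℂ)) :
    word U (l ++ l') = word U l * word U l' := by simp [word]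

@[simp] lemma withAdjoint_true (U : Matrix (Fin n) (Fin n) ℂ) : withAdjoint U true = Uᴴ := rfl

@[simp] lemma withAdjoint_false (U : Matrix (Fin n) (Fin n) ℂ) : withAdjoint U false = U := rfl

/-- The sign that the first letter contributes to the derivative of a word. -/
noncomputable def cutSign : List (Bool × Matrix (Fin n) (Fin n) ℂ) → ℂ
  | [] => 0
  | (e, _) :: _ => if e then -1 else 1

/-- The part of the first letter to the left of the point of differentiation. -/
noncomputable def cutLeft (U : Matrix (Fin n) (Fin n) ℂ) :
    List (Bool × Matrix (Fin n) (Fin n) ℂ) → Matrix (Fin n) (Fin n) ℂ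
  | [] => 0
  | (e, _) :: _ => if e then Uᴴ else 1

/-- The part of a word to the right of the point of differentiation in its first letter. -/
noncomputable def cutRight (U : Matrix (Fin n) (Fin n) ℂ) :
    List (Bool × Matrix (Fin n) (Fin n) ℂ) → Matrix (Fin n) (Fin n) ℂ
  | [] => 0
  | (e, D) :: l => (if e then 1 else U) * D * word U l

/-- The derivative of a word in the direction of the right invariant vector field of `X`. -/
noncomputable def wordDeriv (X U : Matrix (Fin n) (Fin n) ℂ)
    (l : List (Bool × Matrix (Fin n) (Fin n) ℂ)) : Matrix (Fin n) (Fin n) ℂ :=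
  ∑ i ∈ Finset.range l.length, cutSign (l.drop i) •
    (word U (l.take i) * cutLeft U (l.drop i) * X * cutRight U (l.drop i))

lemma wordDeriv_cons (X U : Matrix (Fin n) (Fin n) ℂ) (e : Bool) (D : Matrix (Fin n) (Fin n) ℂ)
    (l : List (Bool × Matrix (Fin n) (Fin n) ℂ)) :
    wordDeriv X U ((e, D) :: l) =
      (if e then -(Uᴴ * X) else X * U) * (D * word U l) +
        withAdjoint U e * D * wordDeriv X U l := by
  rw [wordDeriv, List.length_cons, Finset.sum_range_succ', add_comm]
  congr 1
  · cases e <;> simp [cutSign, cutLeft, cutRight, mul_assoc]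
  · simp [wordDeriv, Finset.mul_sum, mul_assoc]

lemma wordDeriv_add (X Y U : Matrix (Fin n) (Fin n) ℂ)
    (l : List (Bool × Matrix (Fin n) (Fin n) ℂ)) :
    wordDeriv (X + Y) U l = wordDeriv X U l + wordDeriv Y U l := by
  simp [wordDeriv, mul_add, add_mul, Finset.sum_add_distrib]

lemma wordDeriv_smul (z : ℂ) (X U : Matrix (Fin n) (Fin n) ℂ)
    (l : List (Bool × Matrix (Fin n) (Fin n) ℂ)) :
    wordDeriv (z • X) U l = z • wordDeriv X U l := by
  simp only [wordDeriv, Finset.smul_sum]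
  refine Finset.sum_congr rfl fun i _ => ?_
  rw [mul_smul_comm, smul_mul_assoc, smul_comm]

-- Along `t ↦ exp(tX) U` a letter `U` has derivative `X U`, while skewness of `X` gives `-U* X` for
-- `U*`. This explains the sign and the position of the cut in `cutSign`, `cutLeft` and `cutRight`.
open scoped Matrix.Norms.L2Operator in
lemma hasDerivAt_word {X : Matrix (Fin n) (Fin n) ℂ} (hX : Xᴴ = -X)
    (U : Matrix (Fin n) (Fin n) ℂ) (l : List (Bool × Matrix (Fin n) (Fin n) ℂ)) (t : ℝ) :
    HasDerivAt (fun t : ℝ => word (NormedSpace.exp (t • X) * U) l)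
      (wordDeriv X (NormedSpace.exp (t • X) * U) l) t := by
  have h1 : HasDerivAt (fun t : ℝ => NormedSpace.exp (t • X) * U)
      (X * (NormedSpace.exp (t • X) * U)) t := by
    rw [← mul_assoc]
    exact (hasDerivAt_exp_smul_const' X t).mul_const U
  have h2 : HasDerivAt (fun t : ℝ => (NormedSpace.exp (t • X) * U)ᴴ)
      (-((NormedSpace.exp (t • X) * U)ᴴ * X)) t := by
    have := h1.star
    rwa [Matrix.star_eq_conjTranspose, Matrix.conjTranspose_mul, hX, mul_neg] at this
  induction l with
  | nil => simpa [wordDeriv] using hasDerivAt_const t (1 : Matrix (Fin n) (Fin n) ℂ)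
  | cons p l ih =>
    obtain ⟨e, D⟩ := p
    rw [wordDeriv_cons]
    simp only [word_cons]
    cases e
    · simpa [mul_assoc] using (h1.mul_const D).fun_mul ih
    · simpa [mul_assoc] using (h2.mul_const D).fun_mul ih

open scoped Matrix.Norms.L2Operator in
lemma hasDerivAt_tr_mul_word {X : Matrix (Fin n) (Fin n) ℂ} (hX : Xᴴ = -X)
    (A U : Matrix (Fin n) (Fin n) ℂ) (l : List (Bool × Matrix (Fin n) (Fin n) ℂ)) (t : ℝ) :
    HasDerivAt (fun t : ℝ => tr (A * word (NormedSpace.exp (t • X) * U) l))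
      (tr (A * wordDeriv X (NormedSpace.exp (t • X) * U) l)) t := by
  let T : Matrix (Fin n) (Fin n) ℂ →ₗ[ℝ] ℂ :=
    { toFun := fun B => tr (A * B)
      map_add' := fun B C => by rw [mul_add, tr_add]
      map_smul' := fun r B => by
        rw [mul_smul_comm, ← Complex.coe_smul, tr_smul]; simp }
  exact (LinearMap.toContinuousLinearMap T).hasFDerivAt.comp_hasDerivAt t (hasDerivAt_word hX U l t)

lemma continuous_tr : Continuous (tr : Matrix (Fin n) (Fin n) ℂ → ℂ) := by
  unfold tr
  exact (Continuous.matrix_trace continuous_id).div_const _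

lemma continuous_withAdjoint (e : Bool) :
    Continuous fun U : Matrix (Fin n) (Fin n) ℂ => withAdjoint U e := by
  cases e
  · exact continuous_id
  · exact continuous_id.matrix_conjTranspose

lemma continuous_word (l : List (Bool × Matrix (Fin n) (Fin n) ℂ)) :
    Continuous fun U : Matrix (Fin n) (Fin n) ℂ => word U l := by
  induction l with
  | nil => exact continuous_const
  | cons p l ih =>
    simp only [word_cons]
    exact ((continuous_withAdjoint _).matrix_mul continuous_const).matrix_mul ih

lemma continuous_wordDeriv (X : Matrix (Fin n) (Fin n) ℂ)
    (l : List (Bool × Matrix (Fin n) (Fin n) ℂ)) :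
    Continuous fun U : Matrix (Fin n) (Fin n) ℂ => wordDeriv X U l := by
  induction l with
  | nil => simpa [wordDeriv] using continuous_const
  | cons p l ih =>
    obtain ⟨e, D⟩ := p
    simp only [wordDeriv_cons]
    refine .add (.matrix_mul ?_ (continuous_const.matrix_mul (continuous_word l)))
      (((continuous_withAdjoint e).matrix_mul continuous_const).matrix_mul ih)
    cases e
    · exact continuous_const.matrix_mul continuous_id
    · exact ((continuous_id.matrix_conjTranspose).matrix_mul continuous_const).neg

end Word

/-! ### Haar measure on the unitary group -/

section Measure

variable {n : ℕ}

instance : BorelSpace (Matrix (Fin n) (Fin n) ℂ) :=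
  inferInstanceAs (BorelSpace (Fin n → Fin n → ℂ))

instance : SecondCountableTopology (Matrix (Fin n) (Fin n) ℂ) :=
  inferInstanceAs (SecondCountableTopology (Fin n → Fin n → ℂ))

instance : BorelSpace (Matrix.unitaryGroup (Fin n) ℂ) :=
  Subtype.borelSpace (· ∈ Matrix.unitaryGroup (Fin n) ℂ)

instance : SecondCountableTopology (Matrix.unitaryGroup (Fin n) ℂ) :=
  TopologicalSpace.Subtype.secondCountableTopology {U | U ∈ Matrix.unitaryGroup (Fin n) ℂ}

instance : CompactSpace (Matrix.unitaryGroup (Fin n) ℂ) := by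
  refine isCompact_iff_compactSpace.1 ?_
  have h : IsCompact (Set.univ.pi fun _ => Set.univ.pi fun _ => Metric.closedBall 0 1 :
      Set (Fin n → Fin n → ℂ)) :=
    isCompact_univ_pi fun _ => isCompact_univ_pi fun _ => isCompact_closedBall _ _
  refine IsCompact.of_isClosed_subset (X := Matrix (Fin n) (Fin n) ℂ) h isClosed_unitary ?_
  intro U hU i _ j _
  simpa using entry_norm_bound_of_unitary hU i j

lemma integrable_of_continuous {ν : Measure (Matrix.unitaryGroup (Fin n) ℂ)} [IsFiniteMeasure ν]
    {E : Type*} [NormedAddCommGroup E] [SecondCountableTopology E]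
    {f : Matrix.unitaryGroup (Fin n) ℂ → E} (hf : Continuous f) : Integrable f ν :=
  hf.integrable_of_hasCompactSupport (HasCompactSupport.of_compactSpace f)

/-- Apply Fubini to `f (V⁻¹ * U)`: left invariance in `U` gives `∫ f`, and left invariance in `V`
gives the integral of `f` after inversion. -/
lemma integral_inv_eq {ν : Measure (Matrix.unitaryGroup (Fin n) ℂ)} [IsProbabilityMeasure ν]
    [ν.IsMulLeftInvariant] {f : Matrix.unitaryGroup (Fin n) ℂ → ℝ} (hf : Continuous f) :
    ∫ U, f U⁻¹ ∂ν = ∫ U, f U ∂ν := by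
  have hc : Continuous (Function.uncurry fun V U : Matrix.unitaryGroup (Fin n) ℂ => f (V⁻¹ * U)) :=
    hf.comp (continuous_fst.inv.mul continuous_snd)
  obtain ⟨C, hC⟩ := (isCompact_range hf).isBounded.exists_norm_le
  have h1 : ∫ V, ∫ U, f (V⁻¹ * U) ∂ν ∂ν = ∫ U, f U ∂ν := by
    simp [integral_mul_left_eq_self f]
  have h2 : ∫ U, ∫ V, f (V⁻¹ * U) ∂ν ∂ν = ∫ U, f U⁻¹ ∂ν := by
    have (U : Matrix.unitaryGroup (Fin n) ℂ) : ∫ V, f (V⁻¹ * U) ∂ν = ∫ V, f V⁻¹ ∂ν := by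
      rw [← integral_mul_left_eq_self (fun V => f V⁻¹) U⁻¹]
      simp
    simp [this]
  rw [← h1, ← h2]
  exact (integral_integral_swap (Integrable.of_bound hc.aestronglyMeasurable C
    (ae_of_all _ fun p => hC _ ⟨_, rfl⟩))).symm

lemma exp_smul_mem_unitaryGroup {X : Matrix (Fin n) (Fin n) ℂ} (hX : Xᴴ = -X) (t : ℝ) :
    NormedSpace.exp (t • X) ∈ Matrix.unitaryGroup (Fin n) ℂ := by
  rw [Matrix.mem_unitaryGroup_iff, Matrix.star_eq_conjTranspose, ← Matrix.exp_conjTranspose,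
    Matrix.conjTranspose_smul, hX, smul_neg, star_trivial, Matrix.exp_neg]
  exact Matrix.mul_nonsing_inv _ ((Matrix.isUnit_iff_isUnit_det _).1 (Matrix.isUnit_exp _))

/-- The integral of a derivative along a right invariant vector field vanishes. -/
lemma integral_deriv_eq_zero {ν : Measure (Matrix.unitaryGroup (Fin n) ℂ)} [IsProbabilityMeasure ν]
    [ν.IsMulLeftInvariant] {X : Matrix (Fin n) (Fin n) ℂ} (hX : Xᴴ = -X)
    {f f' : Matrix (Fin n) (Fin n) ℂ → ℂ} (hf : Continuous f) (hf' : Continuous f')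
    (h : ∀ U t, HasDerivAt (fun t : ℝ => f (NormedSpace.exp (t • X) * U))
      (f' (NormedSpace.exp (t • X) * U)) t) :
    ∫ U : Matrix.unitaryGroup (Fin n) ℂ, f' U ∂ν = 0 := by
  have hc {g : Matrix (Fin n) (Fin n) ℂ → ℂ} (hg : Continuous g) (V : Matrix (Fin n) (Fin n) ℂ) :
      Continuous fun U : Matrix.unitaryGroup (Fin n) ℂ => g (V * U) :=
    hg.comp (continuous_const.matrix_mul continuous_subtype_val)
  obtain ⟨C, hC⟩ := (isCompact_range
    (hf'.comp (continuous_subtype_val (p := (· ∈ Matrix.unitaryGroup (Fin n) ℂ))))).isBounded.exists_norm_le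
  have key := hasDerivAt_integral_of_dominated_loc_of_deriv_le (μ := ν) (x₀ := (0 : ℝ))
    (F := fun t (U : Matrix.unitaryGroup (Fin n) ℂ) => f (NormedSpace.exp (t • X) * U))
    (F' := fun t (U : Matrix.unitaryGroup (Fin n) ℂ) => f' (NormedSpace.exp (t • X) * U))
    (bound := fun _ => C) (s := Set.univ) univ_mem
    (.of_forall fun t => (hc hf _).aestronglyMeasurable) (integrable_of_continuous (hc hf _))
    (hc hf' _).aestronglyMeasurable
    (ae_of_all _ fun U t _ => hC _
      ⟨⟨_, exp_smul_mem_unitaryGroup hX t⟩ * U, rfl⟩)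
    (integrable_const C) (ae_of_all _ fun U t _ => h U t)
  have hconst : (fun t : ℝ => ∫ U : Matrix.unitaryGroup (Fin n) ℂ,
      f (NormedSpace.exp (t • X) * U) ∂ν) = fun _ => ∫ U : Matrix.unitaryGroup (Fin n) ℂ, f U ∂ν := by
    funext t
    exact integral_mul_left_eq_self (μ := ν)
      (fun U : Matrix.unitaryGroup (Fin n) ℂ => f U) ⟨_, exp_smul_mem_unitaryGroup hX t⟩
  have h2 := key.2
  rw [hconst] at h2
  simpa using (h2.unique (hasDerivAt_const _ _))

end Measure

/-! ### The Schwinger-Dyson equation -/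

section LoopEquation

variable {n : ℕ}

lemma continuous_tr_mul_word (A : Matrix (Fin n) (Fin n) ℂ)
    (l : List (Bool × Matrix (Fin n) (Fin n) ℂ)) :
    Continuous fun U : Matrix (Fin n) (Fin n) ℂ => tr (A * word U l) :=
  continuous_tr.comp (continuous_const.matrix_mul (continuous_word l))

lemma continuous_tr_mul_wordDeriv (A X : Matrix (Fin n) (Fin n) ℂ)
    (l : List (Bool × Matrix (Fin n) (Fin n) ℂ)) :
    Continuous fun U : Matrix (Fin n) (Fin n) ℂ => tr (A * wordDeriv X U l) :=
  continuous_tr.comp (continuous_const.matrix_mul (continuous_wordDeriv X l))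

/-- The derivative of `tr (A w) * star (tr w)`, where `w` is a word, extended complex linearly
from skew-Hermitian directions `X` to all directions. -/
noncomputable def loopDeriv (A X U : Matrix (Fin n) (Fin n) ℂ)
    (l : List (Bool × Matrix (Fin n) (Fin n) ℂ)) : ℂ :=
  tr (A * wordDeriv X U l) * star (tr (word U l)) -
    tr (A * word U l) * star (tr (wordDeriv Xᴴ U l))

lemma continuous_loopDeriv (A X : Matrix (Fin n) (Fin n) ℂ)
    (l : List (Bool × Matrix (Fin n) (Fin n) ℂ)) :
    Continuous fun U => loopDeriv A X U l := by
  have h1 := continuous_tr_mul_word 1 l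
  have h2 := continuous_tr_mul_wordDeriv 1 Xᴴ l
  simp only [one_mul] at h1 h2
  exact ((continuous_tr_mul_wordDeriv A X l).mul h1.star).sub
    ((continuous_tr_mul_word A l).mul h2.star)

lemma loopDeriv_add (A X Y U : Matrix (Fin n) (Fin n) ℂ)
    (l : List (Bool × Matrix (Fin n) (Fin n) ℂ)) :
    loopDeriv A (X + Y) U l = loopDeriv A X U l + loopDeriv A Y U l := by
  simp only [loopDeriv, wordDeriv_add, Matrix.conjTranspose_add, mul_add, tr_add, star_add]
  ring

lemma loopDeriv_smul (z : ℂ) (A X U : Matrix (Fin n) (Fin n) ℂ)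
    (l : List (Bool × Matrix (Fin n) (Fin n) ℂ)) :
    loopDeriv A (z • X) U l = z * loopDeriv A X U l := by
  simp only [loopDeriv, wordDeriv_smul, Matrix.conjTranspose_smul, mul_smul_comm, tr_smul,
    star_mul, star_star]
  ring

variable {ν : Measure (Matrix.unitaryGroup (Fin n) ℂ)} [IsProbabilityMeasure ν]
    [ν.IsMulLeftInvariant]

lemma integral_loopDeriv_of_skew (A : Matrix (Fin n) (Fin n) ℂ) {X : Matrix (Fin n) (Fin n) ℂ}
    (hX : Xᴴ = -X) (l : List (Bool × Matrix (Fin n) (Fin n) ℂ)) :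
    ∫ U : Matrix.unitaryGroup (Fin n) ℂ, loopDeriv A X U l ∂ν = 0 := by
  have h0 := continuous_tr_mul_word 1 l
  simp only [one_mul] at h0
  refine integral_deriv_eq_zero hX (f := fun U => tr (A * word U l) * star (tr (word U l)))
    (f' := fun U => loopDeriv A X U l)
    ((continuous_tr_mul_word A l).mul h0.star) (continuous_loopDeriv A X l) fun U t => ?_
  have h1 := hasDerivAt_tr_mul_word hX A U l t
  have h2 := hasDerivAt_tr_mul_word hX 1 U l t
  simp only [one_mul] at h2
  have e : wordDeriv Xᴴ (NormedSpace.exp (t • X) * U) l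
      = (-1 : ℂ) • wordDeriv X (NormedSpace.exp (t • X) * U) l := by
    rw [hX, ← wordDeriv_smul, neg_one_smul]
  refine (h1.fun_mul h2.star).congr_deriv ?_
  simp only [loopDeriv, e, tr_smul]
  simp

/-- Every `X` is a complex combination of two skew-Hermitian matrices and `loopDeriv` is complex
linear in `X`. Hence matrix units, which are not skew-Hermitian, become admissible directions. -/
lemma integral_loopDeriv (A X : Matrix (Fin n) (Fin n) ℂ)
    (l : List (Bool × Matrix (Fin n) (Fin n) ℂ)) :
    ∫ U : Matrix.unitaryGroup (Fin n) ℂ, loopDeriv A X U l ∂ν = 0 := by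
  set Y := X - Xᴴ with hY
  set Z := (-Complex.I) • (X + Xᴴ) with hZ
  have hY' : Yᴴ = -Y := by simp [hY]
  have hZ' : Zᴴ = -Z := by simp [hZ, add_comm]
  have e : X = (1 / 2 : ℂ) • Y + (Complex.I / 2) • Z := by
    have : Complex.I / 2 * -Complex.I = 1 / 2 := by
      linear_combination (-1 / 2 : ℂ) * Complex.I_mul_I
    rw [hY, hZ, smul_smul, this, ← smul_add]
    ext i j
    simp
    ring
  have hi (W : Matrix (Fin n) (Fin n) ℂ) (z : ℂ) : Integrable
      (fun U : Matrix.unitaryGroup (Fin n) ℂ => z * loopDeriv A W U l) ν :=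
    integrable_of_continuous
      (continuous_const.mul ((continuous_loopDeriv A W l).comp continuous_subtype_val))
  rw [e]
  simp only [loopDeriv_add, loopDeriv_smul]
  rw [integral_add (hi _ _) (hi _ _), integral_const_mul, integral_const_mul,
    integral_loopDeriv_of_skew A hY', integral_loopDeriv_of_skew A hZ']
  simp

lemma trace_single_mul (i j : Fin n) (A : Matrix (Fin n) (Fin n) ℂ) :
    (Matrix.single i j 1 * A).trace = A j i := by
  simp [Matrix.trace_single_mul]

/-- Summation over matrix units splits one trace into two: `∑ A i i * B j j` is the product of the
unnormalized traces. This is the source of the factorized main term of the loop equation. -/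
lemma sum_tr_single_mul_single (A B : Matrix (Fin n) (Fin n) ℂ) :
    ∑ i, ∑ j, tr (Matrix.single j i 1 * (A * Matrix.single i j 1 * B)) = n * tr A * tr B := by
  have (i j : Fin n) : tr (Matrix.single j i 1 * (A * Matrix.single i j 1 * B))
      = A i i * B j j / n := by
    rw [tr, trace_single_mul, Matrix.mul_apply]
    congr 1
    rw [Finset.sum_eq_single j] <;> simp +contextual [Matrix.mul_single_apply_of_ne]
  simp_rw [this, ← Finset.sum_div, ← Finset.mul_sum, ← Finset.sum_mul]
  rw [natCast_mul_tr, tr, Matrix.trace, Matrix.trace]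
  simp [mul_div_assoc]

/-- Here the sum merges two traces into one and gains `1/n`. In the loop equation this makes the
terms from the conjugated factor small. -/
lemma sum_tr_single_mul_star (W G : Matrix (Fin n) (Fin n) ℂ) :
    ∑ i, ∑ j, tr (Matrix.single j i 1 * W) * star (tr (Matrix.single j i 1 * G))
      = tr (W * Gᴴ) / n := by
  simp only [tr, trace_single_mul, star_div₀, star_natCast, div_mul_div_comm, ← Finset.sum_div]
  rw [div_div]
  simp [Matrix.trace, Matrix.mul_apply]

lemma tr_wordDeriv (X U : Matrix (Fin n) (Fin n) ℂ) (l : List (Bool × Matrix (Fin n) (Fin n) ℂ)) :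
    tr (wordDeriv X U l) = ∑ i ∈ Finset.range l.length, cutSign (l.drop i) *
      tr (X * (cutRight U (l.drop i) * (word U (l.take i) * cutLeft U (l.drop i)))) := by
  rw [wordDeriv, tr_sum]
  refine Finset.sum_congr rfl fun i _ => ?_
  rw [tr_smul, mul_assoc, tr_mul_comm, mul_assoc]

lemma star_cutSign (l : List (Bool × Matrix (Fin n) (Fin n) ℂ)) :
    star (cutSign l) = cutSign l := by
  rcases l with _ | ⟨⟨_ | _, D⟩, l⟩ <;> simp [cutSign]

/-- The two sides of the Schwinger-Dyson equation for a word times its conjugate. -/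
noncomputable def loopSum (U : Matrix (Fin n) (Fin n) ℂ)
    (l : List (Bool × Matrix (Fin n) (Fin n) ℂ)) : ℂ :=
  ∑ k ∈ Finset.range l.length, (n * (cutSign (l.drop k) *
    (tr (word U (l.take k) * cutLeft U (l.drop k)) * tr (cutRight U (l.drop k)) *
      star (tr (word U l)))) -
    cutSign (l.drop k) * tr (word U l *
      (cutRight U (l.drop k) * (word U (l.take k) * cutLeft U (l.drop k)))ᴴ) / n)

lemma sum_loopDeriv (U : Matrix (Fin n) (Fin n) ℂ) (l : List (Bool × Matrix (Fin n) (Fin n) ℂ)) :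
    ∑ i, ∑ j, loopDeriv (Matrix.single j i 1) (Matrix.single i j 1) U l = loopSum U l := by
  rw [loopSum]
  simp only [loopDeriv, Finset.sum_sub_distrib]
  congr 1
  · simp only [wordDeriv, Finset.mul_sum, mul_smul_comm, tr_sum, tr_smul, Finset.sum_mul]
    rw [Finset.sum_congr rfl fun i _ => Finset.sum_comm, Finset.sum_comm]
    refine Finset.sum_congr rfl fun k _ => ?_
    simp only [← Finset.mul_sum, ← Finset.sum_mul, mul_assoc (cutSign _)]
    have := sum_tr_single_mul_single (word U (l.take k) * cutLeft U (l.drop k))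
      (cutRight U (l.drop k))
    rw [this]
    ring
  · simp only [Matrix.conjTranspose_single, star_one, tr_wordDeriv, star_sum, star_mul,
      star_cutSign, Finset.mul_sum]
    rw [Finset.sum_congr rfl fun i _ => Finset.sum_comm, Finset.sum_comm]
    refine Finset.sum_congr rfl fun k _ => ?_
    rw [mul_div_assoc, ← sum_tr_single_mul_star, Finset.mul_sum]
    refine Finset.sum_congr rfl fun i _ => ?_
    rw [Finset.mul_sum]
    refine Finset.sum_congr rfl fun j _ => ?_
    ring

lemma continuous_loopSum (l : List (Bool × Matrix (Fin n) (Fin n) ℂ)) :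
    Continuous fun U => loopSum U l := by
  simp_rw [← sum_loopDeriv]
  exact continuous_finsetSum _ fun i _ => continuous_finsetSum _ fun j _ => continuous_loopDeriv _ _ l

lemma integral_loopSum (l : List (Bool × Matrix (Fin n) (Fin n) ℂ)) :
    ∫ U : Matrix.unitaryGroup (Fin n) ℂ, loopSum (U : Matrix (Fin n) (Fin n) ℂ) l ∂ν = 0 := by
  simp_rw [← sum_loopDeriv]
  have hi (i j : Fin n) : Integrable (fun U : Matrix.unitaryGroup (Fin n) ℂ =>
      loopDeriv (Matrix.single j i 1) (Matrix.single i j 1) U l) ν :=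
    integrable_of_continuous ((continuous_loopDeriv _ _ l).comp continuous_subtype_val)
  rw [integral_finsetSum _ fun i _ => integrable_finsetSum _ fun j _ => hi i j]
  refine Finset.sum_eq_zero fun i _ => ?_
  rw [integral_finsetSum _ fun j _ => hi i j]
  exact Finset.sum_eq_zero fun j _ => integral_loopDeriv _ _ l

end LoopEquation

/-! ### The second moment of the trace of a reduced word -/

section MainEstimate

variable {n : ℕ}

/-- Between a letter `U` and a letter `U*`, in either order, the word has a matrix of trace zero. -/
def IsReduced (l : List (Bool × Matrix (Fin n) (Fin n) ℂ)) : Prop :=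
  l.IsChain fun p q => p.1 ≠ q.1 → tr p.2 = 0

variable {T : Set (Matrix (Fin n) (Fin n) ℂ)} {U : Matrix (Fin n) (Fin n) ℂ}

lemma isProdOfLe_withAdjoint (hT : ∀ V ∈ Matrix.unitaryGroup (Fin n) ℂ, V ∈ T)
    (hU : U ∈ Matrix.unitaryGroup (Fin n) ℂ) (e : Bool) : IsProdOfLe T 1 (withAdjoint U e) := by
  cases e
  · exact .of_mem (hT _ hU)
  · exact .of_mem (hT _ (Unitary.star_mem hU))

lemma isProdOfLe_word (hT : ∀ V ∈ Matrix.unitaryGroup (Fin n) ℂ, V ∈ T)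
    (hU : U ∈ Matrix.unitaryGroup (Fin n) ℂ) {l : List (Bool × Matrix (Fin n) (Fin n) ℂ)}
    (hl : ∀ p ∈ l, p.2 ∈ T) : IsProdOfLe T (2 * l.length) (word U l) := by
  induction l with
  | nil => exact .one _
  | cons p l ih =>
    rw [word_cons, List.length_cons, mul_add, add_comm]
    exact ((isProdOfLe_withAdjoint hT hU _).mul (.of_mem (hl p (by simp)))).mul
      (ih fun q hq => hl q (by simp [hq]))

lemma isProdOfLe_cutLeft (hT : ∀ V ∈ Matrix.unitaryGroup (Fin n) ℂ, V ∈ T)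
    (hU : U ∈ Matrix.unitaryGroup (Fin n) ℂ) {l : List (Bool × Matrix (Fin n) (Fin n) ℂ)}
    (hl : l ≠ []) : IsProdOfLe T 1 (cutLeft U l) := by
  rcases l with _ | ⟨⟨_ | _, D⟩, l⟩
  · exact absurd rfl hl
  · exact .one _
  · exact isProdOfLe_withAdjoint hT hU true

lemma isProdOfLe_cutRight (hT : ∀ V ∈ Matrix.unitaryGroup (Fin n) ℂ, V ∈ T)
    (hU : U ∈ Matrix.unitaryGroup (Fin n) ℂ) {l : List (Bool × Matrix (Fin n) (Fin n) ℂ)}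
    (hl : l ≠ []) (h : ∀ p ∈ l, p.2 ∈ T) : IsProdOfLe T (2 * l.length) (cutRight U l) := by
  rcases l with _ | ⟨⟨e, D⟩, l⟩
  · exact absurd rfl hl
  · have h1 : IsProdOfLe T 1 (if e then 1 else U) := by
      cases e
      · exact isProdOfLe_withAdjoint hT hU false
      · exact .one _
    have h2 : IsProdOfLe T 1 D := .of_mem (h (e, D) (by simp))
    have h3 := isProdOfLe_word hT hU (l := l) fun q hq => h q (by simp [hq])
    refine ((h1.mul h2).mul h3).mono (le_of_eq ?_)
    rw [List.length_cons]
    ring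

lemma norm_cutSign {l : List (Bool × Matrix (Fin n) (Fin n) ℂ)} (hl : l ≠ []) :
    ‖cutSign l‖ = 1 := by
  rcases l with _ | ⟨⟨_ | _, D⟩, l⟩ <;> simp_all [cutSign]

lemma word_conjTranspose_left (U : Matrix (Fin n) (Fin n) ℂ)
    (l : List (Bool × Matrix (Fin n) (Fin n) ℂ)) :
    word Uᴴ l = word U (l.map fun p => (!p.1, p.2)) := by
  induction l with
  | nil => rfl
  | cons p l ih =>
    obtain ⟨e, D⟩ := p
    cases e <;> simp [ih]

lemma IsReduced.map_not {l : List (Bool × Matrix (Fin n) (Fin n) ℂ)} (hl : IsReduced l) :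
    IsReduced (l.map fun p => (!p.1, p.2)) := by
  rw [IsReduced, List.isChain_map]
  exact hl.imp fun p q h hpq => h (by simpa using hpq)

/-- Consequence of the Schwinger-Dyson equation, before integration. -/
lemma norm_tr_word_sq_le_loopSum (hn : n ≠ 0) {c : ℝ} {D : Matrix (Fin n) (Fin n) ℂ}
    {s : List (Bool × Matrix (Fin n) (Fin n) ℂ)}
    (hT : ∀ V ∈ Matrix.unitaryGroup (Fin n) ℂ, V ∈ T) (hT' : ∀ A ∈ T, Aᴴ ∈ T)
    (hc : TraceBounded (4 * (s.length + 2)) c T) (hU : U ∈ Matrix.unitaryGroup (Fin n) ℂ)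
    (hl : ∀ p ∈ (false, D) :: s, p.2 ∈ T) :
    ‖tr (word U ((false, D) :: s))‖ ^ 2 ≤ 2 / n * (loopSum U ((false, D) :: s)).re +
      s.length * c ^ 2 * ∑ k ∈ Finset.range s.length,
        ‖tr (word U (((false, D) :: s).take (k + 1)) * cutLeft U (((false, D) :: s).drop (k + 1)))‖ ^ 2
      + 2 * (s.length + 1) * c / n ^ 2 := by
  have hn' : (0 : ℝ) < n := by positivity
  set l := (false, D) :: s with hl'
  have hlen : l.length = s.length + 1 := rfl
  set f := tr (word U l)
  have hB (k : ℕ) (hk : k < l.length) : ‖tr (cutRight U (l.drop k))‖ ≤ c := by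
    refine hc.norm_tr_le ((isProdOfLe_cutRight hT hU (by simpa using hk)
      fun p hp => hl p (List.mem_of_mem_drop hp)).mono ?_)
    simp only [List.length_drop]; omega
  have hH (k : ℕ) (hk : k < l.length) : ‖tr (word U l * (cutRight U (l.drop k) *
      (word U (l.take k) * cutLeft U (l.drop k)))ᴴ)‖ ≤ c := by
    have hne : l.drop k ≠ [] := by simpa using hk
    refine hc.norm_tr_le (((isProdOfLe_word hT hU hl).mul (.conjTranspose hT'
      ((isProdOfLe_cutRight hT hU hne fun p hp => hl p (List.mem_of_mem_drop hp)).mul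
      ((isProdOfLe_word hT hU fun p hp => hl p (List.mem_of_mem_take hp)).mul
        (isProdOfLe_cutLeft hT hU hne))))).mono ?_)
    simp only [List.length_drop, List.length_take]; omega
  have hc0 : 0 ≤ c := (norm_nonneg _).trans (hB 0 (by simp [hlen]))
  set a : ℕ → ℂ := fun k => cutSign (l.drop k) *
    (tr (word U (l.take k) * cutLeft U (l.drop k)) * tr (cutRight U (l.drop k)))
  set b : ℕ → ℂ := fun k => cutSign (l.drop k) * tr (word U l *
      (cutRight U (l.drop k) * (word U (l.take k) * cutLeft U (l.drop k)))ᴴ)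
  -- The cut at the first letter has an empty left part, of trace one, and the whole word as right
  -- part. It contributes `n |f|²`, which is isolated here.
  have hS : loopSum U l = ∑ k ∈ Finset.range s.length, (n : ℂ) * (a (k + 1) * star f)
      + n * (f * star f) - (∑ k ∈ Finset.range l.length, b k) / n := by
    rw [loopSum, Finset.sum_sub_distrib, Finset.sum_div, hlen, Finset.sum_range_succ']
    congr 2
    · refine Finset.sum_congr rfl fun k _ => ?_
      simp only [a, f]; ring
    · simp [cutSign, cutLeft, cutRight, hl', tr_one hn, f, mul_assoc]
  have hff : f * star f = ((‖f‖ ^ 2 : ℝ) : ℂ) := by simpa using Complex.mul_conj' f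
  have ha (k : ℕ) (hk : k < l.length) : ‖a k‖ ≤
      c * ‖tr (word U (l.take k) * cutLeft U (l.drop k))‖ := by
    simp only [a, norm_mul]
    rw [norm_cutSign (by simpa using hk), one_mul, mul_comm]
    gcongr
    exact hB k hk
  have hb (k : ℕ) (hk : k < l.length) : ‖b k‖ ≤ c := by
    simp only [b]
    rw [norm_mul, norm_cutSign (by simpa using hk), one_mul]
    exact hH k hk
  set A := ∑ k ∈ Finset.range s.length, ‖a (k + 1)‖
  have h1 : n * ‖f‖ ^ 2 ≤ (loopSum U l).re + n * (A * ‖f‖) + (s.length + 1) * c / n := by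
    have e : ((n * ‖f‖ ^ 2 : ℝ) : ℂ) = loopSum U l
        - ∑ k ∈ Finset.range s.length, (n : ℂ) * (a (k + 1) * star f)
        + (∑ k ∈ Finset.range l.length, b k) / n := by
      rw [hS, hff]; push_cast; ring
    have e' := congrArg Complex.re e
    rw [Complex.ofReal_re, Complex.add_re, Complex.sub_re] at e'
    have i1 : ‖∑ k ∈ Finset.range s.length, (n : ℂ) * (a (k + 1) * star f)‖ ≤ n * (A * ‖f‖) := by
      refine (norm_sum_le _ _).trans (le_of_eq ?_)
      simp [A, Finset.sum_mul, Finset.mul_sum]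
    have i2 : ‖(∑ k ∈ Finset.range l.length, b k) / n‖ ≤ (s.length + 1) * c / n := by
      rw [norm_div, Complex.norm_natCast]
      gcongr
      refine (norm_sum_le_of_le _ fun k hk => hb k (Finset.mem_range.1 hk)).trans (le_of_eq ?_)
      simp [hlen]
    have i3 := (abs_le.1 (Complex.abs_re_le_norm
      (∑ k ∈ Finset.range s.length, (n : ℂ) * (a (k + 1) * star f)))).1
    have i4 := (Complex.re_le_norm ((∑ k ∈ Finset.range l.length, b k) / n))
    linarith
  have h2 : A ^ 2 ≤ s.length * c ^ 2 * ∑ k ∈ Finset.range s.length,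
      ‖tr (word U (l.take (k + 1)) * cutLeft U (l.drop (k + 1)))‖ ^ 2 := by
    have := sq_sum_le_card_mul_sum_sq (s := Finset.range s.length) (f := fun k => ‖a (k + 1)‖)
    rw [Finset.card_range] at this
    refine this.trans ?_
    rw [mul_assoc, Finset.mul_sum (a := c ^ 2)]
    gcongr with k hk
    rw [← mul_pow]
    gcongr
    exact ha _ (by simp only [Finset.mem_range] at hk; omega)
  -- The arithmetic-geometric mean inequality lets half of `n |f|²` be absorbed into the left-hand
  -- side.
  have h3 : n * (A * ‖f‖) ≤ n * (A ^ 2 / 2 + ‖f‖ ^ 2 / 2) := by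
    gcongr
    nlinarith [sq_nonneg (A - ‖f‖)]
  have h4 : n * ‖f‖ ^ 2 ≤ 2 * (loopSum U l).re + n * A ^ 2 + 2 * (s.length + 1) * c / n := by
    have : 2 * (s.length + 1) * c / n = 2 * ((s.length + 1) * c / n) := by ring
    rw [this]
    linarith
  have h5 : ‖f‖ ^ 2 ≤ 2 / n * (loopSum U l).re + A ^ 2 + 2 * (s.length + 1) * c / n ^ 2 := by
    have : 2 / n * (loopSum U l).re + A ^ 2 + 2 * (s.length + 1) * c / n ^ 2 =
      (2 * (loopSum U l).re + n * A ^ 2 + 2 * (s.length + 1) * c / n) / n := by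
      field_simp
    rw [this, le_div_iff₀ hn', mul_comm]
    exact h4
  linarith

lemma TraceBounded.mul_set {m : ℕ} {c : ℝ} (h : TraceBounded (2 * m) c T) :
    TraceBounded m c {A | IsProdOfLe T 2 A} := h.prodLe

/-- The trace of the left part of a cut word is zero or the trace of a shorter reduced word. -/
lemma tr_word_take_mul_cutLeft {D : Matrix (Fin n) (Fin n) ℂ}
    {s : List (Bool × Matrix (Fin n) (Fin n) ℂ)} (hred : IsReduced ((false, D) :: s))
    (hl : ∀ p ∈ (false, D) :: s, p.2 ∈ T) {k : ℕ} (hk : k < s.length) :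
    (∀ U ∈ Matrix.unitaryGroup (Fin n) ℂ, tr (word U (((false, D) :: s).take (k + 1)) *
        cutLeft U (((false, D) :: s).drop (k + 1))) = 0) ∨
      ∃ l' : List (Bool × Matrix (Fin n) (Fin n) ℂ), l' ≠ [] ∧ l'.length < s.length + 1 ∧
        IsReduced l' ∧ (∀ p ∈ l', IsProdOfLe T 2 p.2) ∧
        ∀ U ∈ Matrix.unitaryGroup (Fin n) ℂ, tr (word U (((false, D) :: s).take (k + 1)) *
          cutLeft U (((false, D) :: s).drop (k + 1))) = tr (word U l') := by
  have hdrop : ((false, D) :: s).drop (k + 1) = s[k] :: s.drop (k + 1) := by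
    simp
  rw [hdrop]
  rcases he : s[k] with ⟨_ | _, E⟩
  · right
    refine ⟨((false, D) :: s).take (k + 1), by simp, by simp; omega, hred.take _,
      fun p hp => (IsProdOfLe.of_mem (hl p (List.mem_of_mem_take hp))).mono (by norm_num),
      fun U hU => by simp [cutLeft]⟩
  · have hcyc (U) (hU : U ∈ Matrix.unitaryGroup (Fin n) ℂ) :
        tr (word U (((false, D) :: s).take (k + 1)) * cutLeft U ((true, E) :: s.drop (k + 1)))
          = tr (word U (s.take k) * D) := by
      have hUU : Uᴴ * U = 1 := Matrix.mem_unitaryGroup_iff'.1 hU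
      simp only [List.take_succ_cons, word_cons, cutLeft, if_true, withAdjoint_false]
      rw [tr_mul_comm, ← mul_assoc, ← mul_assoc, hUU, one_mul, tr_mul_comm]
    rcases List.eq_nil_or_concat (s.take k) with h | ⟨t, ⟨e', D'⟩, h⟩
    · left
      intro U hU
      rw [hcyc U hU, h, word_nil, one_mul]
      have hk0 : k = 0 := by
        have := congrArg List.length h
        simp at this
        rcases this with h | h
        · exact h
        · subst h; simp at hk
      subst hk0
      rcases s with _ | ⟨p, s⟩
      · simp at hk
      · simp only [List.getElem_cons_zero] at he
        subst he
        exact (List.isChain_cons_cons.1 hred).1 (by simp)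
    · rw [List.concat_eq_append] at h
      right
      have hs : ∀ p ∈ s.take k, p ∈ s := fun p hp => List.mem_of_mem_take hp
      have hlen := congrArg List.length h
      simp only [List.length_take, List.length_append, List.length_cons, List.length_nil] at hlen
      have hch : IsReduced (t ++ [(e', D')]) := by
        have := List.IsChain.take hred.tail k
        rw [List.tail_cons, h] at this
        exact this
      rw [h] at hs
      -- `D` is merged into the last matrix of the shorter word. Reducedness does not constrain that
      -- matrix, so no centering is lost; the price is a product of two elements of `T`.
      refine ⟨t ++ [(e', D' * D)], by simp, by simp; omega, ?_, ?_, ?_⟩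
      · rw [IsReduced, List.isChain_append] at hch ⊢
        refine ⟨hch.1, by simp, fun x hx y hy => ?_⟩
        simp at hy
        subst hy
        exact hch.2.2 x hx (e', D') (by simp)
      · intro p hp
        rcases List.mem_append.1 hp with hp | hp
        · exact (IsProdOfLe.of_mem (hl p (by simp [hs p (by simp [hp])]))).mono (by norm_num)
        · simp at hp
          subst hp
          exact (IsProdOfLe.of_mem (hl (e', D') (List.mem_cons_of_mem _ (hs _ (by simp))))).mul
            (.of_mem (hl (false, D) (by simp)))
      · intro U hU
        rw [hcyc U hU, h]
        simp [mul_assoc]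

lemma continuous_norm_tr_word_sq (l : List (Bool × Matrix (Fin n) (Fin n) ℂ)) :
    Continuous fun U : Matrix.unitaryGroup (Fin n) ℂ =>
      ‖tr (word (U : Matrix (Fin n) (Fin n) ℂ) l)‖ ^ 2 :=
  ((continuous_tr.comp (continuous_word l)).norm.pow 2).comp continuous_subtype_val

end MainEstimate

/-- The trace of a reduced word in a Haar unitary matrix and trace bounded deterministic matrices
is of order `1 / n` in mean square. -/
theorem integral_norm_tr_word_sq_le (L : ℕ) (c : ℝ) : ∃ C : ℝ, 0 ≤ C ∧
    ∀ (n : ℕ) (ν : Measure (Matrix.unitaryGroup (Fin n) ℂ)) [IsProbabilityMeasure ν]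
      [ν.IsMulLeftInvariant] (T : Set (Matrix (Fin n) (Fin n) ℂ)),
      (∀ V ∈ Matrix.unitaryGroup (Fin n) ℂ, V ∈ T) → (∀ A ∈ T, Aᴴ ∈ T) →
      TraceBounded (4 ^ (L + 1)) c T →
      ∀ l : List (Bool × Matrix (Fin n) (Fin n) ℂ), l ≠ [] → l.length = L →
        (∀ p ∈ l, p.2 ∈ T) → IsReduced l →
        ∫ U : Matrix.unitaryGroup (Fin n) ℂ,
          ‖tr (word (U : Matrix (Fin n) (Fin n) ℂ) l)‖ ^ 2 ∂ν ≤ C / n ^ 2 := by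
  induction L using Nat.strong_induction_on with
  | _ L ih =>
  choose! C hC0 hC using ih
  set M := ∑ j ∈ Finset.range L, C j
  have hM (j) (hj : j < L) : C j ≤ M :=
    Finset.single_le_sum (f := C) (fun i hi => hC0 i (Finset.mem_range.1 hi)) (Finset.mem_range.2 hj)
  have hM0 : 0 ≤ M := Finset.sum_nonneg fun i hi => hC0 i (Finset.mem_range.1 hi)
  -- The first term comes from Cauchy-Schwarz over at most `L` cuts, right parts bounded by `c`, and
  -- shorter words bounded by `M / n²`. The second comes from the merged traces. The modulus of `c`
  -- makes nonnegativity visible before any trace bound is available.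
  refine ⟨L * c ^ 2 * (L * M) + 2 * (L + 1) * |c|, by positivity, ?_⟩
  intro n ν _ _ T hT hT' hc
  rcases eq_or_ne n 0 with rfl | hn
  · intro l _ _ _ _
    simp [tr]
  have hn' : (0 : ℝ) < n := by positivity
  have hc0 : 0 ≤ c := (norm_nonneg _).trans (hc [] (by simp) (by simp))
  have hbound (D : Matrix (Fin n) (Fin n) ℂ) (s : List (Bool × Matrix (Fin n) (Fin n) ℂ))
      (hs : s.length + 1 = L) (hl : ∀ p ∈ (false, D) :: s, p.2 ∈ T)
      (hred : IsReduced ((false, D) :: s)) :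
      ∫ U : Matrix.unitaryGroup (Fin n) ℂ,
        ‖tr (word (U : Matrix (Fin n) (Fin n) ℂ) ((false, D) :: s))‖ ^ 2 ∂ν ≤
        (L * c ^ 2 * (L * M) + 2 * (L + 1) * |c|) / n ^ 2 := by
    -- The longest product in the loop equation consists of the word, the adjoint of its two cut
    -- parts and one more `U*`: fewer than `4 * (s.length + 2)` factors.
    have hpow : 4 * (s.length + 2) ≤ 4 ^ (L + 1) := by
      rw [pow_succ, mul_comm]
      gcongr
      have := (Nat.lt_pow_self (n := L) (a := 4) (by norm_num))
      omega
    have hsplit (k : ℕ) (hk : k < s.length) : Integrable (fun U : Matrix.unitaryGroup (Fin n) ℂ =>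
        ‖tr (word (U : Matrix (Fin n) (Fin n) ℂ) (((false, D) :: s).take (k + 1)) *
          cutLeft (U : Matrix (Fin n) (Fin n) ℂ) (((false, D) :: s).drop (k + 1)))‖ ^ 2) ν ∧
        ∫ U : Matrix.unitaryGroup (Fin n) ℂ,
        ‖tr (word (U : Matrix (Fin n) (Fin n) ℂ) (((false, D) :: s).take (k + 1)) *
          cutLeft (U : Matrix (Fin n) (Fin n) ℂ) (((false, D) :: s).drop (k + 1)))‖ ^ 2 ∂ν
          ≤ M / n ^ 2 := by
      rcases tr_word_take_mul_cutLeft hred hl hk with h | ⟨l', h1, h2, h3, h4, h5⟩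
      · have (U : Matrix.unitaryGroup (Fin n) ℂ) := h U U.2
        simp only [this]
        simp only [norm_zero, ne_eq, OfNat.ofNat_ne_zero, not_false_eq_true, zero_pow,
          integral_zero]
        exact ⟨integrable_zero _ _ _, by positivity⟩
      · have (U : Matrix.unitaryGroup (Fin n) ℂ) := h5 U U.2
        simp only [this]
        refine ⟨integrable_of_continuous (continuous_norm_tr_word_sq l'), ?_⟩
        refine (hC l'.length (by omega) n ν {A | IsProdOfLe T 2 A}
          (fun V hV => (IsProdOfLe.of_mem (hT V hV)).mono (by norm_num))
          (fun A hA => hA.conjTranspose hT') ?_ l' h1 rfl h4 h3).trans ?_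
        · refine TraceBounded.mul_set (hc.mono ?_)
          -- Passing to products of two elements halves the admissible number of factors; an
          -- allowance growing like `4 ^ L` survives this at each decrease of the length.
          calc 2 * 4 ^ (l'.length + 1) ≤ 4 * 4 ^ (l'.length + 1) := by gcongr; norm_num
            _ = 4 ^ (l'.length + 1 + 1) := by ring
            _ ≤ 4 ^ (L + 1) := by gcongr <;> omega
        · gcongr
          exact hM _ (by omega)
    have hre : ∫ U : Matrix.unitaryGroup (Fin n) ℂ,
        (loopSum (U : Matrix (Fin n) (Fin n) ℂ) ((false, D) :: s)).re ∂ν = 0 := by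
      have := integral_re (𝕜 := ℂ) (integrable_of_continuous (ν := ν)
        ((continuous_loopSum ((false, D) :: s)).comp continuous_subtype_val))
      simp only [Function.comp_def, integral_loopSum] at this
      simpa using this
    have hloop : Integrable (fun U : Matrix.unitaryGroup (Fin n) ℂ =>
        2 / n * (loopSum (U : Matrix (Fin n) (Fin n) ℂ) ((false, D) :: s)).re) ν :=
      integrable_of_continuous (continuous_const.mul (Complex.continuous_re.comp
        ((continuous_loopSum ((false, D) :: s)).comp continuous_subtype_val)))
    have hsum := (integrable_finsetSum (Finset.range s.length) fun k hk =>
        (hsplit k (Finset.mem_range.1 hk)).1).const_mul (s.length * c ^ 2)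
    have hconst := integrable_const (μ := ν) (2 * (s.length + 1) * c / n ^ 2 : ℝ)
    have hint := integral_mono (integrable_of_continuous (continuous_norm_tr_word_sq _))
      ((hloop.add hsum).add hconst) fun U => norm_tr_word_sq_le_loopSum hn hT hT'
        (hc.mono hpow) U.2 hl
    refine hint.trans ?_
    simp only [Pi.add_apply]
    rw [integral_add (by exact hloop.add hsum) hconst, integral_add hloop hsum,
      integral_const_mul, integral_const_mul, hre,
      integral_finsetSum _ fun k hk => (hsplit k (Finset.mem_range.1 hk)).1]
    have h1 := Finset.sum_le_sum fun k hk => (hsplit k (Finset.mem_range.1 hk)).2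
    rw [Finset.sum_const, Finset.card_range, nsmul_eq_mul] at h1
    have hsL : (s.length : ℝ) ≤ L := by rw [← hs]; push_cast; linarith
    simp only [integral_const, probReal_univ, smul_eq_mul, one_mul, mul_zero, zero_add]
    calc _ ≤ s.length * c ^ 2 * (s.length * (M / n ^ 2)) + 2 * (s.length + 1) * c / n ^ 2 := by
          gcongr
      _ ≤ L * c ^ 2 * (L * (M / n ^ 2)) + 2 * (L + 1) * |c| / n ^ 2 := by
          rw [abs_of_nonneg hc0]
          gcongr
      _ = _ := by ring
  intro l hne hlen hl hred
  rcases l with _ | ⟨⟨_ | _, D⟩, s⟩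
  · exact absurd rfl hne
  · exact hbound D s (by simpa using hlen) hl hred
  · have h := integral_inv_eq (ν := ν) (continuous_norm_tr_word_sq ((true, D) :: s))
    rw [← h]
    have e (U : Matrix.unitaryGroup (Fin n) ℂ) :
        word ((U⁻¹ : Matrix.unitaryGroup (Fin n) ℂ) : Matrix (Fin n) (Fin n) ℂ) ((true, D) :: s)
          = word U ((false, D) :: s.map fun p => (!p.1, p.2)) := by
      have hU : ((U⁻¹ : Matrix.unitaryGroup (Fin n) ℂ) : Matrix (Fin n) (Fin n) ℂ) =
        (U : Matrix (Fin n) (Fin n) ℂ)ᴴ := rfl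
      rw [hU, word_conjTranspose_left]
      rfl
    simp only [e]
    refine hbound D _ (by simpa using hlen) ?_ hred.map_not
    intro p hp
    rcases List.mem_cons.1 hp with rfl | hp
    · exact hl (true, D) (by simp)
    · obtain ⟨q, hq, rfl⟩ := List.mem_map.1 hp
      exact hl q (by simp [hq])

/-! ### Countable family of word patterns -/

section Signature

variable {n : ℕ}

/-- The value at `(R, R*)` of a word, centered on demand. -/
noncomputable def letterValue (R : Matrix (Fin n) (Fin n) ℂ) (x : Bool × FreeMonoid Bool) :
    Matrix (Fin n) (Fin n) ℂ :=
  FreeMonoid.lift (withAdjoint R) x.2 -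
    (if x.1 then tr (FreeMonoid.lift (withAdjoint R) x.2) else 0) • (1 : Matrix (Fin n) (Fin n) ℂ)

/-- The word in a unitary matrix and the matrices `letterValue R x`. -/
noncomputable def signatureWord (U R : Matrix (Fin n) (Fin n) ℂ)
    (s : List (Bool × Bool × FreeMonoid Bool)) : Matrix (Fin n) (Fin n) ℂ :=
  word U (s.map fun x => (x.1, letterValue R x.2))

/-- Where the exponent changes its sign, the letter is centered. -/
def IsCenteredSignature (s : List (Bool × Bool × FreeMonoid Bool)) : Prop :=
  s.IsChain fun x y => x.1 ≠ y.1 → x.2.1 = true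

lemma tr_letterValue_true (R : Matrix (Fin n) (Fin n) ℂ) (w : FreeMonoid Bool) :
    tr (letterValue R (true, w)) = 0 := by
  rcases eq_or_ne n 0 with rfl | hn
  · simp [tr]
  · simp [letterValue, tr_sub, tr_smul, tr_one hn]

lemma IsCenteredSignature.isReduced {s : List (Bool × Bool × FreeMonoid Bool)}
    (hs : IsCenteredSignature s) (R : Matrix (Fin n) (Fin n) ℂ) :
    IsReduced (s.map fun x => (x.1, letterValue R x.2)) := by
  rw [IsReduced, List.isChain_map]
  refine hs.imp fun x y h hxy => ?_
  obtain ⟨e, b, w⟩ := x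
  obtain rfl : b = true := h hxy
  exact tr_letterValue_true R w

lemma isProdOfLe_lift {T : Set (Matrix (Fin n) (Fin n) ℂ)} {R : Matrix (Fin n) (Fin n) ℂ}
    (h : ∀ b, withAdjoint R b ∈ T) (w : FreeMonoid Bool) :
    IsProdOfLe T w.length (FreeMonoid.lift (withAdjoint R) w) := by
  refine ⟨w.toList.map (withAdjoint R), ?_, ?_, ?_⟩
  · simp [FreeMonoid.length]
  · intro B hB
    obtain ⟨b, _, rfl⟩ := List.mem_map.1 hB
    exact h b
  · rw [FreeMonoid.lift_apply]

end Signature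

/-- The letters of a signature lie in a trace bounded set of matrices, with bounds that depend only
on the signature and on a bound for the Schatten norms. -/
lemma exists_traceBounded_letterValue (s : List (Bool × Bool × FreeMonoid Bool)) {m : ℕ}
    (hm : 0 < m) : ∃ K : ℕ, ∀ b : ℝ, 1 ≤ b → ∃ c : ℝ, ∀ (n : ℕ) (R : Matrix (Fin n) (Fin n) ℂ),
      (∀ k ≤ K, schattenPow k R ≤ b) → ∃ T : Set (Matrix (Fin n) (Fin n) ℂ),
        (∀ V ∈ Matrix.unitaryGroup (Fin n) ℂ, V ∈ T) ∧ (∀ A ∈ T, Aᴴ ∈ T) ∧ TraceBounded m c T ∧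
        ∀ p ∈ s.map fun x => (x.1, letterValue R x.2), p.2 ∈ T := by
  -- The added one ensures that a single unitary factor counts as a product of at most `d` factors.
  set d := (s.map fun x => x.2.2.length).sum + 1
  -- A product of `m` letters involves up to `d * m` elementary factors; centering then turns `b`
  -- into `b * (1 + b) ^ m`.
  refine ⟨d * m, fun b hb => ⟨b * (1 + b) ^ m, fun n R hR => ?_⟩⟩
  set T₀ : Set (Matrix (Fin n) (Fin n) ℂ) := {A | A ∈ Matrix.unitaryGroup (Fin n) ℂ ∨ A = R ∨ A = Rᴴ}
  have hT₀ : TraceBounded (d * m) b T₀ := by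
    refine traceBounded_of_schattenPow_le hb fun A hA k hk => ?_
    rcases hA with hA | rfl | rfl
    · exact (schattenPow_le_one_of_mem_unitaryGroup k hA).trans hb
    · exact hR k hk
    · rw [schattenPow_conjTranspose]
      exact hR k hk
  have hT₀' : ∀ A ∈ T₀, Aᴴ ∈ T₀ := by
    rintro A (hA | rfl | rfl)
    · exact Or.inl (Unitary.star_mem hA)
    · exact Or.inr (Or.inr rfl)
    · exact Or.inr (Or.inl (Matrix.conjTranspose_conjTranspose R))
  have hW (w : FreeMonoid Bool) := isProdOfLe_lift (T := T₀) (R := R)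
    (fun b => by cases b <;> simp [T₀]) w
  refine ⟨{A | ∃ B ∈ {A | IsProdOfLe T₀ d A}, ∃ z : ℂ, ‖z‖ ≤ b ∧ A = B - z • 1},
    ?_, ?_, hT₀.prodLe.sub_smul_one (by linarith), ?_⟩
  · exact fun V hV => ⟨V, (IsProdOfLe.of_mem (Or.inl hV)).mono (by simp [d]), 0, by simp; linarith,
      by simp⟩
  · rintro _ ⟨B, hB, z, hz, rfl⟩
    exact ⟨Bᴴ, hB.conjTranspose hT₀', star z, by simpa using hz, by simp⟩
  · intro p hp
    obtain ⟨⟨e, c, w⟩, hx, rfl⟩ := List.mem_map.1 hp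
    have hwd : w.length ≤ d := by
      have := List.single_le_sum (l := s.map fun x => x.2.2.length) (by simp) _
        (List.mem_map_of_mem (f := fun x => x.2.2.length) hx)
      simp only at this
      omega
    refine ⟨_, (hW w).mono hwd, _, ?_, rfl⟩
    split_ifs
    · exact hT₀.norm_tr_le ((hW w).mono (hwd.trans (Nat.le_mul_of_pos_right d hm)))
    · simp; linarith

/-- The mean square bound for words in a Haar unitary matrix and a deterministic matrix and its
adjoint. -/
lemma integral_norm_tr_signatureWord_sq_le {s : List (Bool × Bool × FreeMonoid Bool)}
    (hne : s ≠ []) (hs : IsCenteredSignature s) : ∃ K : ℕ, ∀ b : ℝ, 1 ≤ b → ∃ C : ℝ, 0 ≤ C ∧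
    ∀ (n : ℕ) (ν : Measure (Matrix.unitaryGroup (Fin n) ℂ)) [IsProbabilityMeasure ν]
      [ν.IsMulLeftInvariant] (R : Matrix (Fin n) (Fin n) ℂ), (∀ k ≤ K, schattenPow k R ≤ b) →
      ∫ U : Matrix.unitaryGroup (Fin n) ℂ,
        ‖tr (signatureWord (U : Matrix (Fin n) (Fin n) ℂ) R s)‖ ^ 2 ∂ν ≤ C / n ^ 2 := by
  obtain ⟨K, hK⟩ := exists_traceBounded_letterValue s (m := 4 ^ (s.length + 1)) (by positivity)
  refine ⟨K, fun b hb => ?_⟩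
  obtain ⟨c, hc⟩ := hK b hb
  obtain ⟨C, hC0, hC⟩ := integral_norm_tr_word_sq_le s.length c
  refine ⟨C, hC0, fun n ν _ _ R hR => ?_⟩
  obtain ⟨T, h1, h2, h3, h4⟩ := hc n R hR
  exact hC n ν T h1 h2 h3 _ (by simpa using hne) (by simp) h4 (hs.isReduced R)

/-! ### Schatten norms as spectral moments, and continuity -/

section Moments

variable {n : ℕ}

lemma tr_pow_of_isHermitian {A : Matrix (Fin n) (Fin n) ℂ} (hA : A.IsHermitian) (k : ℕ) :
    tr (A ^ k) = ((∑ i, hA.eigenvalues i ^ k : ℝ) : ℂ) / n := by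
  conv_lhs => rw [hA.spectral_theorem, ← map_pow, Unitary.conjStarAlgAut_apply, tr_mul_comm,
    ← mul_assoc, Unitary.coe_star_mul_self, one_mul, Matrix.diagonal_pow]
  simp [tr, Matrix.trace]

lemma schattenPow_eq_integral (k : ℕ) (A : Matrix (Fin n) (Fin n) ℂ) :
    schattenPow k A = ∫ x, x ^ 2 ^ k
      ∂(empiricalEigenvalueDistribution (Matrix.isHermitian_mul_conjTranspose_self A)) := by
  rw [schattenPow, tr_pow_of_isHermitian (Matrix.isHermitian_mul_conjTranspose_self A),
    empiricalEigenvalueDistribution, integral_smul_measure,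
    integral_finsetSum_measure fun i _ => integrable_dirac (by simp)]
  simp only [integral_dirac, Complex.div_natCast_re, Complex.ofReal_re]
  simp [div_eq_inv_mul]

lemma continuous_schattenPow (k : ℕ) :
    Continuous fun A : Matrix (Fin n) (Fin n) ℂ => schattenPow k A := by
  unfold schattenPow
  exact Complex.continuous_re.comp (continuous_tr.comp
    ((continuous_id.matrix_mul continuous_id.matrix_conjTranspose).pow _))

lemma continuous_lift_withAdjoint (w : FreeMonoid Bool) :
    Continuous fun R : Matrix (Fin n) (Fin n) ℂ => FreeMonoid.lift (withAdjoint R) w := by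
  simp only [FreeMonoid.lift_apply]
  exact continuous_list_prod _ fun b _ => continuous_withAdjoint b

lemma continuous_letterValue (x : Bool × FreeMonoid Bool) :
    Continuous fun R : Matrix (Fin n) (Fin n) ℂ => letterValue R x := by
  unfold letterValue
  have h : Continuous fun R : Matrix (Fin n) (Fin n) ℂ =>
      if x.1 then tr (FreeMonoid.lift (withAdjoint R) x.2) else 0 := by
    split_ifs
    · exact continuous_tr.comp (continuous_lift_withAdjoint _)
    · exact continuous_const
  exact (continuous_lift_withAdjoint _).sub (h.smul continuous_const)

lemma continuous_signatureWord (s : List (Bool × Bool × FreeMonoid Bool)) :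
    Continuous fun p : Matrix.unitaryGroup (Fin n) ℂ × Matrix (Fin n) (Fin n) ℂ =>
      signatureWord (p.1 : Matrix (Fin n) (Fin n) ℂ) p.2 s := by
  induction s with
  | nil => exact continuous_const
  | cons x s ih =>
    simp only [signatureWord, List.map_cons, word_cons]
    exact (((continuous_withAdjoint x.1).comp (continuous_subtype_val.comp continuous_fst)).matrix_mul
      ((continuous_letterValue x.2).comp continuous_snd)).matrix_mul ih

lemma measurable_norm_tr_signatureWord_sq (s : List (Bool × Bool × FreeMonoid Bool)) :
    Measurable fun p : Matrix.unitaryGroup (Fin n) ℂ × Matrix (Fin n) (Fin n) ℂ =>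
      ENNReal.ofReal (‖tr (signatureWord (p.1 : Matrix (Fin n) (Fin n) ℂ) p.2 s)‖ ^ 2) :=
  ((continuous_tr.comp (continuous_signatureWord s)).norm.pow 2).measurable.ennreal_ofReal

end Moments

/-! ### Almost sure convergence for one signature -/

section Probability

variable {Ω : Type*} [MeasurableSpace Ω] {μ : Measure Ω}

/-- The quantities `schattenPow k` are moments of `R R*` of order `2 ^ k`, and convergent real
sequences are bounded. -/
lemma ae_schattenPow_bdd {R : (n : ℕ) → Ω → Matrix (Fin n) (Fin n) ℂ} {ρ : Measure ℝ}
    (hconv : ∀ᵐ ω ∂μ, ConvergesInDistribution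
      (fun n => empiricalEigenvalueDistribution
        (Matrix.isHermitian_mul_conjTranspose_self (R n ω))) ρ) :
    ∀ᵐ ω ∂μ, ∀ k, ∃ B, ∀ n, schattenPow k (R n ω) ≤ B := by
  filter_upwards [hconv] with ω hω k
  obtain ⟨B, hB⟩ := (hω (2 ^ k)).bddAbove_range
  refine ⟨B, fun n => ?_⟩
  rw [schattenPow_eq_integral]
  exact hB ⟨n, rfl⟩

variable [IsProbabilityMeasure μ]

/-- By independence the joint law is a product, so Fubini freezes `R = A` and leaves the Haar
integral over `U`. The set `S` cuts off matrices for which the deterministic bound is not available.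
-/
lemma lintegral_signatureWord_le {n : ℕ} {U : Ω → Matrix.unitaryGroup (Fin n) ℂ}
    {R : Ω → Matrix (Fin n) (Fin n) ℂ} (hU : IsStandardUnitary μ U) (hR : Measurable R)
    (hUR : IndepFun U R μ) {S : Set (Matrix (Fin n) (Fin n) ℂ)} (hS : MeasurableSet S) {C : ℝ}
    (s : List (Bool × Bool × FreeMonoid Bool))
    (h : ∀ (ν : Measure (Matrix.unitaryGroup (Fin n) ℂ)) [IsProbabilityMeasure ν]
      [ν.IsMulLeftInvariant], ∀ A ∈ S, ∫ V : Matrix.unitaryGroup (Fin n) ℂ,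
        ‖tr (signatureWord (V : Matrix (Fin n) (Fin n) ℂ) A s)‖ ^ 2 ∂ν ≤ C) :
    ∫⁻ ω, (R ⁻¹' S).indicator (fun ω => ENNReal.ofReal
      (‖tr (signatureWord (U ω : Matrix (Fin n) (Fin n) ℂ) (R ω) s)‖ ^ 2)) ω ∂μ
      ≤ ENNReal.ofReal C := by
  obtain ⟨hUm, hUp, hUh⟩ := hU
  set F : Matrix.unitaryGroup (Fin n) ℂ × Matrix (Fin n) (Fin n) ℂ → ENNReal :=
    (Prod.snd ⁻¹' S).indicator fun p => ENNReal.ofReal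
      (‖tr (signatureWord (p.1 : Matrix (Fin n) (Fin n) ℂ) p.2 s)‖ ^ 2) with hF
  have hFm : Measurable F :=
    (measurable_norm_tr_signatureWord_sq s).indicator (measurable_snd hS)
  have hmap := (indepFun_iff_map_prod_eq_prod_map_map hUm.aemeasurable hR.aemeasurable).1 hUR
  have hRp : IsProbabilityMeasure (μ.map R) := Measure.isProbabilityMeasure_map hR.aemeasurable
  calc _ = ∫⁻ ω, F (U ω, R ω) ∂μ := rfl
    _ = ∫⁻ p, F p ∂((μ.map U).prod (μ.map R)) := by
      rw [← hmap, lintegral_map hFm (hUm.prodMk hR)]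
    _ = ∫⁻ A, ∫⁻ V, F (V, A) ∂(μ.map U) ∂(μ.map R) := lintegral_prod_symm _ hFm.aemeasurable
    _ ≤ ∫⁻ _, ENNReal.ofReal C ∂(μ.map R) := by
      refine lintegral_mono fun A => ?_
      by_cases hA : A ∈ S
      · have : ∀ V, F (V, A) = ENNReal.ofReal
            (‖tr (signatureWord (V : Matrix (Fin n) (Fin n) ℂ) A s)‖ ^ 2) := fun V => by
          simp [hF, hA]
        have hint : Integrable (fun V : Matrix.unitaryGroup (Fin n) ℂ =>
            ‖tr (signatureWord (V : Matrix (Fin n) (Fin n) ℂ) A s)‖ ^ 2) (μ.map U) :=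
          integrable_of_continuous (continuous_norm_tr_word_sq _)
        simp only [this]
        rw [← ofReal_integral_eq_lintegral_ofReal hint
          (ae_of_all _ fun V => by positivity)]
        exact ENNReal.ofReal_le_ofReal (h _ A hA)
      · simp [hF, hA]
    _ = ENNReal.ofReal C := by simp

/-- The truncated squares have expectations `O(1/n²)`, so their sum is almost surely finite and the
terms tend to zero. The moment bound of a realization is random, but some integer level of
truncation exceeds it. -/
lemma ae_tendsto_tr_signatureWord {U : (n : ℕ) → Ω → Matrix.unitaryGroup (Fin n) ℂ}
    {R : (n : ℕ) → Ω → Matrix (Fin n) (Fin n) ℂ} (hU : ∀ n, IsStandardUnitary μ (U n))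
    (hR : ∀ n, Measurable (R n)) (hUR : ∀ n, IndepFun (U n) (R n) μ)
    (hbdd : ∀ᵐ ω ∂μ, ∀ k, ∃ B, ∀ n, schattenPow k (R n ω) ≤ B)
    {s : List (Bool × Bool × FreeMonoid Bool)} (hne : s ≠ []) (hs : IsCenteredSignature s) :
    ∀ᵐ ω ∂μ, Tendsto (fun n => tr (signatureWord (U n ω : Matrix (Fin n) (Fin n) ℂ) (R n ω) s))
      atTop (𝓝 0) := by
  obtain ⟨K, hK⟩ := integral_norm_tr_signatureWord_sq_le hne hs
  set S : ℕ → (n : ℕ) → Set (Matrix (Fin n) (Fin n) ℂ) :=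
    fun b n => {A | ∀ k ≤ K, schattenPow k A ≤ b + 1} with hS
  have hSm (b n) : MeasurableSet (S b n) := by
    refine IsClosed.measurableSet ?_
    simp only [hS, Set.ofPred_forall]
    exact isClosed_iInter fun k => isClosed_iInter fun _ =>
      isClosed_le (continuous_schattenPow k) continuous_const
  have hsum (b : ℕ) : ∀ᵐ ω ∂μ, Tendsto (fun n => (R n ⁻¹' S b n).indicator (fun ω => ENNReal.ofReal
      (‖tr (signatureWord (U n ω : Matrix (Fin n) (Fin n) ℂ) (R n ω) s)‖ ^ 2)) ω) atTop (𝓝 0) := by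
    obtain ⟨C, hC0, hC⟩ := hK (b + 1) (by simp)
    have hm (n) : Measurable ((R n ⁻¹' S b n).indicator (fun ω => ENNReal.ofReal
        (‖tr (signatureWord (U n ω : Matrix (Fin n) (Fin n) ℂ) (R n ω) s)‖ ^ 2))) := by
      have h := (measurable_norm_tr_signatureWord_sq s).comp ((hU n).1.prodMk (hR n))
      exact h.indicator (hR n (hSm b n))
    have hle : ∫⁻ ω, ∑' n, (R n ⁻¹' S b n).indicator (fun ω => ENNReal.ofReal
        (‖tr (signatureWord (U n ω : Matrix (Fin n) (Fin n) ℂ) (R n ω) s)‖ ^ 2)) ω ∂μ ≠ ⊤ := by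
      rw [lintegral_tsum fun n => (hm n).aemeasurable]
      refine ne_top_of_le_ne_top ?_ (ENNReal.tsum_le_tsum fun n =>
        lintegral_signatureWord_le (C := C / n ^ 2) (hU n) (hR n) (hUR n) (hSm b n) s
          fun ν _ _ A hA => hC n ν A hA)
      have hsm : Summable fun n : ℕ => C / (n : ℝ) ^ 2 := by
        simpa [div_eq_mul_inv] using (Real.summable_nat_pow_inv.2 (by norm_num : 1 < 2)).mul_left C
      rw [← ENNReal.ofReal_tsum_of_nonneg (fun n => by positivity) hsm]
      exact ENNReal.ofReal_ne_top
    filter_upwards [ae_lt_top (Measurable.tsum hm) hle] with ω hω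
    exact ENNReal.tendsto_atTop_zero_of_tsum_ne_top hω.ne
  filter_upwards [ae_all_iff.2 hsum, hbdd] with ω h1 h2
  choose B hB using h2
  -- Only the finitely many indices `k ≤ K` matter, so a single level `b` dominates them for all
  -- `n`.
  obtain ⟨b, hb⟩ := exists_nat_ge (∑ k ∈ Finset.range (K + 1), |B k|)
  have hmem (n) : R n ω ∈ S b n := by
    intro k hk
    have := Finset.single_le_sum (f := fun k => |B k|) (fun _ _ => abs_nonneg _)
      (Finset.mem_range.2 (Nat.lt_succ_of_le hk))
    have h3 := hB k n
    have h4 := le_abs_self (B k)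
    linarith
  have h3 := h1 b
  simp only [Set.indicator_of_mem (Set.mem_preimage.2 (hmem _))] at h3
  have h4 := (ENNReal.tendsto_toReal ENNReal.zero_ne_top).comp h3
  simp only [Function.comp_def, ENNReal.toReal_zero] at h4
  have h5 : Tendsto (fun n => ‖tr (signatureWord (U n ω : Matrix (Fin n) (Fin n) ℂ) (R n ω) s)‖ ^ 2)
      atTop (𝓝 0) := by
    refine h4.congr fun n => ENNReal.toReal_ofReal (by positivity)
  rw [tendsto_zero_iff_norm_tendsto_zero]
  have h6 := h5.sqrt
  simpa using h6

end Probability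

/-! ### Multilinear expansion into signatures -/

section Multilinear

variable {n : ℕ}

/-- `D` is a linear combination of the words from `W` at `(A, A*)`, with coefficients of modulus at
most `C`. -/
def IsBoundedComb (A : Matrix (Fin n) (Fin n) ℂ) (W : Finset (FreeMonoid Bool)) (C : ℝ)
    (D : Matrix (Fin n) (Fin n) ℂ) : Prop :=
  ∃ c : FreeMonoid Bool → ℂ, (∀ w ∈ W, ‖c w‖ ≤ C) ∧
    D = ∑ w ∈ W, c w • FreeMonoid.lift (withAdjoint A) w

lemma IsBoundedComb.mono {A : Matrix (Fin n) (Fin n) ℂ} {W : Finset (FreeMonoid Bool)} {C C' : ℝ}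
    {D : Matrix (Fin n) (Fin n) ℂ} (h : IsBoundedComb A W C D) (hC : C ≤ C') :
    IsBoundedComb A W C' D := by
  obtain ⟨c, h1, h2⟩ := h
  exact ⟨c, fun w hw => (h1 w hw).trans hC, h2⟩

lemma isBoundedComb_one (A : Matrix (Fin n) (Fin n) ℂ) {W : Finset (FreeMonoid Bool)} (hW : 1 ∈ W) :
    IsBoundedComb A W 1 1 := by
  classical
  refine ⟨fun w => if w = 1 then 1 else 0, fun w _ => ?_, ?_⟩
  · dsimp only
    split_ifs <;> simp
  · simp [ite_smul, hW]

lemma sum_letterValue_true (A : Matrix (Fin n) (Fin n) ℂ) (W : Finset (FreeMonoid Bool))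
    (c : FreeMonoid Bool → ℂ) :
    ∑ w ∈ W, c w • letterValue A (true, w) = ∑ w ∈ W, c w • FreeMonoid.lift (withAdjoint A) w
      - tr (∑ w ∈ W, c w • FreeMonoid.lift (withAdjoint A) w) • 1 := by
  simp [letterValue, smul_sub, Finset.sum_sub_distrib, tr_sum, tr_smul, Finset.sum_smul, smul_smul]

lemma letterValue_false (A : Matrix (Fin n) (Fin n) ℂ) (w : FreeMonoid Bool) :
    letterValue A (false, w) = FreeMonoid.lift (withAdjoint A) w := by
  simp [letterValue]

lemma signatureWord_append_singleton (U A : Matrix (Fin n) (Fin n) ℂ)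
    (s : List (Bool × Bool × FreeMonoid Bool)) (x : Bool × Bool × FreeMonoid Bool) :
    signatureWord U A (s ++ [x]) =
      signatureWord U A s * (withAdjoint U x.1 * letterValue A x.2) := by
  simp [signatureWord]

lemma signatureWord_cons (U A : Matrix (Fin n) (Fin n) ℂ)
    (s : List (Bool × Bool × FreeMonoid Bool)) (x : Bool × Bool × FreeMonoid Bool) :
    signatureWord U A (x :: s) = withAdjoint U x.1 * letterValue A x.2 * signatureWord U A s := by
  simp [signatureWord]

open Classical in
/-- The signature `s` describes one of the terms in the expansion of the word of `l`. -/
def IsExpansionTerm (W : Finset (FreeMonoid Bool)) (l : List (Bool × Matrix (Fin n) (Fin n) ℂ))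
    (s : List (Bool × Bool × FreeMonoid Bool)) : Prop :=
  List.Forall₂ (fun p x => x.1 = p.1 ∧ x.2.1 = decide (tr p.2 = 0) ∧ x.2.2 ∈ W) l s

lemma IsExpansionTerm.isCenteredSignature {W : Finset (FreeMonoid Bool)}
    {l : List (Bool × Matrix (Fin n) (Fin n) ℂ)} {s : List (Bool × Bool × FreeMonoid Bool)}
    (h : IsExpansionTerm W l s) (hl : IsReduced l) : IsCenteredSignature s := by
  induction h with
  | nil => exact .nil
  | @cons p x l s hpx hls ih =>
    have hs := ih hl.tail
    cases hls with
    | nil => exact .singleton _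
    | @cons q y l s hqy hls =>
      refine List.isChain_cons_cons.2 ⟨fun hxy => ?_, hs⟩
      have := (List.isChain_cons_cons.1 hl).1 (by rwa [hpx.1, hqy.1] at hxy)
      simpa [hpx.2.1] using this

/-- Each matrix is expanded into words of `W`, which costs a factor `C * W.card` per letter. The
prefix `X` carries the letters already expanded. -/
lemma norm_tr_mul_word_le (U A : Matrix (Fin n) (Fin n) ℂ) (W : Finset (FreeMonoid Bool)) {C δ : ℝ}
    (hC : 0 ≤ C) (l : List (Bool × Matrix (Fin n) (Fin n) ℂ))
    (hl : ∀ p ∈ l, IsBoundedComb A W C p.2) :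
    ∀ X, (∀ s, IsExpansionTerm W l s → ‖tr (X * signatureWord U A s)‖ ≤ δ) →
      ‖tr (X * word U l)‖ ≤ (C * W.card) ^ l.length * δ := by
  induction l with
  | nil =>
    intro X h
    simpa [signatureWord] using h [] .nil
  | cons p l ih =>
    intro X h
    classical
    obtain ⟨c, hc, hp⟩ := hl p (by simp)
    set b := decide (tr p.2 = 0) with hb
    -- If `D` has trace zero, centering every word subtracts `tr D = 0` in total, so the same
    -- coefficients express `D` by centered words.
    have hD : p.2 = ∑ w ∈ W, c w • letterValue A (b, w) := by
      by_cases ht : tr p.2 = 0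
      · rw [hb, decide_eq_true ht, sum_letterValue_true, ← hp, ht, zero_smul, sub_zero]
      · rw [hb, decide_eq_false ht]
        simpa only [letterValue_false] using hp
    have e : tr (X * word U (p :: l)) = ∑ w ∈ W, c w *
        tr (X * (withAdjoint U p.1 * letterValue A (b, w)) * word U l) := by
      rw [word_cons]
      nth_rw 1 [hD]
      simp only [Finset.mul_sum, Finset.sum_mul, tr_sum, mul_smul_comm, smul_mul_assoc, tr_smul,
        mul_assoc]
    rw [e]
    have hw (w) (hw : w ∈ W) : ‖c w * tr (X * (withAdjoint U p.1 * letterValue A (b, w)) * word U l)‖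
        ≤ C * ((C * W.card) ^ l.length * δ) := by
      rw [norm_mul]
      refine mul_le_mul (hc w hw) (ih (fun q hq => hl q (by simp [hq])) _ fun s hs => ?_)
        (norm_nonneg _) hC
      have := h ((p.1, b, w) :: s) (.cons ⟨rfl, rfl, hw⟩ hs)
      rwa [signatureWord_cons, ← mul_assoc X] at this
    refine (norm_sum_le_of_le _ hw).trans (le_of_eq ?_)
    rw [Finset.sum_const, nsmul_eq_mul, List.length_cons]
    ring

lemma finite_lists_of_mem {α : Type*} {F : Set α} (hF : F.Finite) (L : ℕ) :
    {l : List α | l.length = L ∧ ∀ x ∈ l, x ∈ F}.Finite := by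
  induction L with
  | zero =>
    refine (Set.finite_singleton ([] : List α)).subset ?_
    rintro l ⟨h, -⟩
    simpa using h
  | succ L ih =>
    refine (hF.image2 List.cons ih).subset ?_
    rintro (_ | ⟨x, l⟩) ⟨h, h'⟩
    · simp at h
    · exact ⟨x, h' x (by simp), l, ⟨by simpa using h, fun y hy => h' y (by simp [hy])⟩, rfl⟩

end Multilinear

/-! ### Uniformity over bounded combinations -/

section Sequences

variable {V : (n : ℕ) → Matrix (Fin n) (Fin n) ℂ} {A : (n : ℕ) → Matrix (Fin n) (Fin n) ℂ}

/-- Convergence to zero along all centered signatures is uniform over bounded combinations. -/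
lemma eventually_norm_tr_word_lt
    (H : ∀ s, s ≠ [] → IsCenteredSignature s →
      Tendsto (fun n => tr (signatureWord (V n) (A n) s)) atTop (𝓝 0))
    (W : Finset (FreeMonoid Bool)) (C : ℝ) {L : ℕ} (hL : L ≠ 0) {ε : ℝ} (hε : 0 < ε) :
    ∀ᶠ n in atTop, ∀ l : List (Bool × Matrix (Fin n) (Fin n) ℂ), l.length = L →
      (∀ p ∈ l, IsBoundedComb (A n) W C p.2) → IsReduced l → ‖tr (word (V n) l)‖ < ε := by
  -- For fixed length and fixed `W` only finitely many signatures occur, so their convergences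
  -- combine.
  have hfin : {s : List (Bool × Bool × FreeMonoid Bool) | (s.length = L ∧
      ∀ x ∈ s, x ∈ (Set.univ ×ˢ Set.univ ×ˢ (W : Set (FreeMonoid Bool)))) ∧
      IsCenteredSignature s}.Finite :=
    (finite_lists_of_mem (Set.finite_univ.prod (Set.finite_univ.prod W.finite_toSet)) L).subset
      fun s hs => hs.1
  set B := (|C| * W.card) ^ L
  have hB : 0 ≤ B := by positivity
  set δ := ε / (B + 1)
  have hδ : 0 < δ := by positivity
  have hev := (Filter.eventually_all_finite hfin (l := atTop)
    (p := fun s n => ‖tr (signatureWord (V n) (A n) s)‖ < δ)).2 (fun s hs => by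
      have hne : s ≠ [] := by
        rintro rfl
        exact hL hs.1.1.symm
      simpa using (H s hne hs.2).eventually (Metric.ball_mem_nhds 0 hδ))
  filter_upwards [hev] with n hn l hl hlW hred
  have := norm_tr_mul_word_le (V n) (A n) W (abs_nonneg C) (δ := δ) l
    (fun p hp => (hlW p hp).mono (le_abs_self C)) 1 (fun s hs => by
      rw [one_mul]
      refine (hn s ⟨⟨?_, fun x hx => ?_⟩, hs.isCenteredSignature hred⟩).le
      · rw [← hl]; exact (List.Forall₂.length_eq hs).symm
      · obtain ⟨i, hi, rfl⟩ := List.getElem_of_mem hx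
        have := (List.forall₂_iff_get.1 hs).2 i (by rwa [List.Forall₂.length_eq hs]) hi
        simpa using this.2.2)
  rw [one_mul, hl] at this
  refine this.trans_lt ?_
  change B * (ε / (B + 1)) < ε
  rw [mul_div_assoc', div_lt_iff₀ (by positivity)]
  nlinarith

end Sequences

/-! ### Alternating products as reduced words -/

section AlternatingProduct

variable {n : ℕ}

/-- The word that represents `U ^ m * D`. -/
noncomputable def powWord (m : ℤ) (D : Matrix (Fin n) (Fin n) ℂ) :
    List (Bool × Matrix (Fin n) (Fin n) ℂ) :=
  List.replicate (m.natAbs - 1) (decide (m < 0), 1) ++ [(decide (m < 0), D)]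

lemma length_powWord {m : ℤ} (hm : m ≠ 0) (D : Matrix (Fin n) (Fin n) ℂ) :
    (powWord m D).length = m.natAbs := by
  have := Int.natAbs_pos.2 hm
  simp [powWord]
  omega

lemma word_replicate (U : Matrix (Fin n) (Fin n) ℂ) (k : ℕ) (e : Bool) :
    word U (List.replicate k (e, 1)) = withAdjoint U e ^ k := by
  simp [word]

lemma word_powWord (U : Matrix.unitaryGroup (Fin n) ℂ) {m : ℤ} (hm : m ≠ 0)
    (D : Matrix (Fin n) (Fin n) ℂ) :
    word (U : Matrix (Fin n) (Fin n) ℂ) (powWord m D) =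
      ((U ^ m : Matrix.unitaryGroup (Fin n) ℂ) : Matrix (Fin n) (Fin n) ℂ) * D := by
  have hpos := Int.natAbs_pos.2 hm
  have h1 : word (U : Matrix (Fin n) (Fin n) ℂ) (powWord m D) =
      withAdjoint (U : Matrix (Fin n) (Fin n) ℂ) (decide (m < 0)) ^ m.natAbs * D := by
    rw [powWord, word_append, word_replicate, word_cons, word_nil, mul_one, ← mul_assoc,
      ← pow_succ, Nat.sub_add_cancel hpos]
  rw [h1]
  congr 1
  rcases lt_or_ge m 0 with h | h
  · have h2 : m = -(m.natAbs : ℤ) := by omega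
    have h3 : ((U⁻¹ : Matrix.unitaryGroup (Fin n) ℂ) : Matrix (Fin n) (Fin n) ℂ) =
      (U : Matrix (Fin n) (Fin n) ℂ)ᴴ := rfl
    rw [decide_eq_true h, withAdjoint_true, ← h3]
    conv_rhs => rw [h2, zpow_neg, zpow_natCast, ← inv_pow]
    rfl
  · have h2 : m = (m.natAbs : ℤ) := by omega
    rw [decide_eq_false (not_lt.2 h), withAdjoint_false]
    conv_rhs => rw [h2, zpow_natCast]
    rfl

lemma mem_powWord {m : ℤ} {D : Matrix (Fin n) (Fin n) ℂ} {p : Bool × Matrix (Fin n) (Fin n) ℂ}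
    (h : p ∈ powWord m D) : p.2 = 1 ∨ p.2 = D := by
  rcases List.mem_append.1 h with h | h
  · left; rw [List.eq_of_mem_replicate h]
  · right; rw [List.mem_singleton.1 h]

/-- Within the block of a power the exponent is constant, so a sign can change only after the last
letter of a block, whose matrix has trace zero. The filler matrices `1` are never at such a place.
-/
lemma isReduced_flatten_powWord (L : List (ℤ × Matrix (Fin n) (Fin n) ℂ))
    (hL : ∀ x ∈ L, tr x.2 = 0) : IsReduced (L.map fun x => powWord x.1 x.2).flatten := by
  induction L with
  | nil => exact .nil
  | cons x L ih =>
    rw [List.map_cons, List.flatten_cons, powWord, List.append_assoc, IsReduced,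
      List.isChain_append]
    refine ⟨List.isChain_replicate_of_rel _ (by simp), ?_, ?_⟩
    · refine List.isChain_cons.2 ⟨fun q _ _ => hL x (by simp), ih fun y hy => hL y (by simp [hy])⟩
    · intro p hp q hq hpq
      rw [List.eq_of_mem_replicate (List.mem_of_mem_getLast? hp)] at hpq
      simp at hq
      subst hq
      exact absurd rfl hpq

lemma alternatingProduct_eq_word {l : ℕ} (U : Matrix.unitaryGroup (Fin n) ℂ) {m : Fin l → ℤ}
    (hm : ∀ i, m i ≠ 0) (D : Fin l → Matrix (Fin n) (Fin n) ℂ) :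
    alternatingProduct U m D =
      word (U : Matrix (Fin n) (Fin n) ℂ)
        ((List.ofFn fun i => (m i, D i)).map fun x => powWord x.1 x.2).flatten := by
  have (L : List (List (Bool × Matrix (Fin n) (Fin n) ℂ))) :
      word (U : Matrix (Fin n) (Fin n) ℂ) L.flatten =
        (L.map (word (U : Matrix (Fin n) (Fin n) ℂ))).prod := by
    induction L with
    | nil => rfl
    | cons l L ih => simp [ih]
  rw [this, alternatingProduct, List.map_map, List.map_ofFn]
  congr 2
  funext i
  simp [word_powWord U (hm i)]

end AlternatingProduct

/-! ### Uniform convergence for alternating products -/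

section Uniform

variable {V : (n : ℕ) → Matrix.unitaryGroup (Fin n) ℂ} {A : (n : ℕ) → Matrix (Fin n) (Fin n) ℂ}

lemma eventually_norm_tr_alternatingProduct_lt
    (H : ∀ s, s ≠ [] → IsCenteredSignature s →
      Tendsto (fun n => tr (signatureWord (V n : Matrix (Fin n) (Fin n) ℂ) (A n) s)) atTop (𝓝 0))
    {W : Finset (FreeMonoid Bool)} (hW : 1 ∈ W) (C : ℝ) {l : ℕ} (hl : 0 < l) {m : Fin l → ℤ}
    (hm : ∀ i, m i ≠ 0) {ε : ℝ} (hε : 0 < ε) :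
    ∀ᶠ n in atTop, ∀ D : Fin l → Matrix (Fin n) (Fin n) ℂ,
      (∀ i, IsBoundedComb (A n) W C (D i)) → (∀ i, tr (D i) = 0) →
      ‖tr (alternatingProduct (V n) m D)‖ < ε := by
  have hL : ∑ i, (m i).natAbs ≠ 0 := by
    have : 0 < (m ⟨0, hl⟩).natAbs := Int.natAbs_pos.2 (hm _)
    have h2 := Finset.single_le_sum (f := fun i => (m i).natAbs) (fun _ _ => Nat.zero_le _)
      (Finset.mem_univ (⟨0, hl⟩ : Fin l))
    omega
  -- The bound `max C 1` also covers the filler matrices `1`, whose only coefficient is one.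
  filter_upwards [eventually_norm_tr_word_lt H W (max C 1) hL hε] with n hn D hD htr
  rw [alternatingProduct_eq_word (V n) hm]
  refine hn _ ?_ ?_ (isReduced_flatten_powWord _ ?_)
  · rw [List.length_flatten, List.map_map, List.map_ofFn, List.sum_ofFn]
    exact Finset.sum_congr rfl fun i _ => length_powWord (hm i) _
  · intro p hp
    simp only [List.map_ofFn, List.mem_flatten, List.mem_ofFn, Function.comp] at hp
    obtain ⟨_, ⟨i, rfl⟩, hp⟩ := hp
    rcases mem_powWord hp with h | h
    · rw [h]; exact (isBoundedComb_one (A n) hW).mono (le_max_right _ _)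
    · rw [h]; exact (hD i).mono (le_max_left _ _)
  · intro x hx
    obtain ⟨i, rfl⟩ := List.mem_ofFn.1 hx
    exact htr i

lemma StarPolynomial.eval_eq_sum {n : ℕ} (A : Matrix (Fin n) (Fin n) ℂ) (P : StarPolynomial)
    {W : Finset (FreeMonoid Bool)} (hW : ∀ w ∉ W, P.coeff w = 0) :
    P.eval A = ∑ w ∈ W, P.coeff w • FreeMonoid.lift (withAdjoint A) w := by
  have h : (FreeAlgebra.lift ℂ (withAdjoint A)) =
      (MonoidAlgebra.lift ℂ _ _ (FreeMonoid.lift (withAdjoint A))).comp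
        (FreeAlgebra.equivMonoidAlgebraFreeMonoid (R := ℂ) (X := Bool)).toAlgHom := by
    ext b : 2
    simp [FreeAlgebra.equivMonoidAlgebraFreeMonoid]
  rw [StarPolynomial.eval, h]
  simp only [AlgHom.comp_apply, MonoidAlgebra.lift_apply]
  refine Finsupp.sum_of_support_subset _ (fun w hw => ?_) _ (by simp)
  by_contra hw'
  exact (Finsupp.mem_support_iff.1 hw) (hW w hw')

lemma exists_finset_words (d : ℕ) : ∃ W : Finset (FreeMonoid Bool), ∀ w, w ∈ W ↔ w.length ≤ d := by
  have h : {w : FreeMonoid Bool | w.length ≤ d}.Finite := List.finite_length_le Bool d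
  exact ⟨h.toFinset, by simp⟩

lemma length_of_pow (b : Bool) (k : ℕ) : (FreeMonoid.of b ^ k).length = k := by
  induction k with
  | zero => rfl
  | succ k ih => rw [pow_succ, FreeMonoid.length_mul, ih, FreeMonoid.length_of]

lemma isBoundedComb_aeval {n : ℕ} (A : Matrix (Fin n) (Fin n) ℂ) {P : Polynomial ℂ} {d : ℕ} {C : ℝ}
    (hd : P.natDegree ≤ d) (hC : ∀ k, ‖P.coeff k‖ ≤ C) :
    IsBoundedComb A ((Finset.range (d + 1)).map ⟨fun k => FreeMonoid.of false ^ k, fun j k h => by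
      simpa [length_of_pow] using congrArg FreeMonoid.length h⟩) C (Polynomial.aeval A P) := by
  refine ⟨fun w => P.coeff w.length, fun w _ => hC _, ?_⟩
  rw [Polynomial.aeval_eq_sum_range' (Nat.lt_succ_of_le hd)]
  rw [Finset.sum_map]
  refine Finset.sum_congr rfl fun k _ => ?_
  change _ = P.coeff (FreeMonoid.of false ^ k).length •
    FreeMonoid.lift (withAdjoint A) (FreeMonoid.of false ^ k)
  rw [length_of_pow, map_pow, FreeMonoid.lift_eval_of, withAdjoint_false]

end Uniform

/-! ### Words in fixed polynomials that are centered only in the limit -/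

section Fixed

variable {V : (n : ℕ) → Matrix (Fin n) (Fin n) ℂ} {A : (n : ℕ) → Matrix (Fin n) (Fin n) ℂ}

lemma exists_finset_eval_eq_sum (q : StarPolynomial) : ∃ W : Finset (FreeMonoid Bool),
    ∀ (n : ℕ) (A : Matrix (Fin n) (Fin n) ℂ),
      q.eval A = ∑ w ∈ W, q.coeff w • FreeMonoid.lift (withAdjoint A) w :=
  ⟨(FreeAlgebra.equivMonoidAlgebraFreeMonoid q).coeff.support, fun _ A =>
    q.eval_eq_sum A fun _ hw => Finsupp.notMem_support_iff.1 hw⟩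

/-- The word in a matrix `U` and the values at `(A, A*)` of fixed polynomials. -/
noncomputable def polyWord {n : ℕ} (U A : Matrix (Fin n) (Fin n) ℂ)
    (l : List (Bool × StarPolynomial)) : Matrix (Fin n) (Fin n) ℂ :=
  word U (l.map fun x => (x.1, x.2.eval A))

lemma polyWord_cons {n : ℕ} (U A : Matrix (Fin n) (Fin n) ℂ) (x : Bool × StarPolynomial)
    (l : List (Bool × StarPolynomial)) :
    polyWord U A (x :: l) = withAdjoint U x.1 * x.2.eval A * polyWord U A l := by
  simp [polyWord]

/-- The polynomials are expanded from the left, and the expanded letters accumulate in the signature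
`s`; the statement is therefore quantified over all `s`. -/
lemma isBoundedUnder_tr_polyWord
    (H : ∀ s, ∃ B, ∀ n, ‖tr (signatureWord (V n) (A n) s)‖ ≤ B)
    (l : List (Bool × StarPolynomial)) : ∀ s, ∃ B, ∀ n,
      ‖tr (signatureWord (V n) (A n) s * polyWord (V n) (A n) l)‖ ≤ B := by
  induction l with
  | nil => simpa [polyWord] using H
  | cons x l ih =>
    intro s
    obtain ⟨W, hW⟩ := exists_finset_eval_eq_sum x.2
    choose B hB using fun w => ih (s ++ [(x.1, false, w)])
    refine ⟨∑ w ∈ W, ‖x.2.coeff w‖ * B w, fun n => ?_⟩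
    have e : tr (signatureWord (V n) (A n) s * polyWord (V n) (A n) (x :: l)) =
        ∑ w ∈ W, x.2.coeff w *
          tr (signatureWord (V n) (A n) (s ++ [(x.1, false, w)]) * polyWord (V n) (A n) l) := by
      simp only [polyWord_cons, hW, signatureWord_append_singleton, letterValue_false,
        Finset.mul_sum, Finset.sum_mul, tr_sum, mul_smul_comm, smul_mul_assoc, tr_smul, mul_assoc]
    rw [e]
    refine norm_sum_le_of_le _ fun w _ => ?_
    rw [norm_mul]
    gcongr
    exact hB w n

/-- Words in which the polynomials are asymptotically centered where the exponent changes its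
sign have asymptotically vanishing trace. -/
lemma tendsto_tr_polyWord
    (H : ∀ s, s ≠ [] → IsCenteredSignature s →
      Tendsto (fun n => tr (signatureWord (V n) (A n) s)) atTop (𝓝 0))
    (H' : ∀ s, ∃ B, ∀ n, ‖tr (signatureWord (V n) (A n) s)‖ ≤ B)
    {l : List (Bool × StarPolynomial)} (hne : l ≠ [])
    (hl : l.IsChain fun x y => x.1 ≠ y.1 → Tendsto (fun n => tr (x.2.eval (A n))) atTop (𝓝 0)) :
    Tendsto (fun n => tr (polyWord (V n) (A n) l)) atTop (𝓝 0) := by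
  classical
  set f : StarPolynomial → Bool :=
    fun q => decide (Tendsto (fun n => tr (q.eval (A n))) atTop (𝓝 0)) with hf
  have hsig (s : List (Bool × Bool × FreeMonoid Bool)) : IsCenteredSignature s ↔
      (s.map fun x => (x.1, x.2.1)).IsChain fun x y => x.1 ≠ y.1 → x.2 = true := by
    rw [IsCenteredSignature, List.isChain_map]
  have key (l : List (Bool × StarPolynomial)) : ∀ s : List (Bool × Bool × FreeMonoid Bool),
      (l = [] → s ≠ []) →
      (List.IsChain (fun x y : Bool × Bool => x.1 ≠ y.1 → x.2 = true)
        ((s.map fun x => (x.1, x.2.1)) ++ l.map fun x => (x.1, f x.2))) →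
      Tendsto (fun n => tr (signatureWord (V n) (A n) s * polyWord (V n) (A n) l)) atTop (𝓝 0) := by
    induction l with
    | nil =>
      intro s hs h
      simpa [polyWord] using H s (hs rfl) ((hsig s).2 (by simpa using h))
    | cons x l ih =>
      intro s _ h
      obtain ⟨W, hW⟩ := exists_finset_eval_eq_sum x.2
      have h1 (w : FreeMonoid Bool) := ih (s ++ [(x.1, f x.2, w)]) (by simp) (by simpa using h)
      have h2 : Tendsto (fun n => ∑ w ∈ W, x.2.coeff w *
          tr (signatureWord (V n) (A n) (s ++ [(x.1, f x.2, w)]) * polyWord (V n) (A n) l))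
          atTop (𝓝 0) := by
        simpa using tendsto_finsetSum W fun w _ => (h1 w).const_mul (x.2.coeff w)
      by_cases hx : Tendsto (fun n => tr (x.2.eval (A n))) atTop (𝓝 0)
      · obtain ⟨B, hB⟩ := isBoundedUnder_tr_polyWord H' l (s ++ [(x.1, false, 1)])
        have h3 : Tendsto (fun n => tr (x.2.eval (A n)) * tr (signatureWord (V n) (A n)
            (s ++ [(x.1, false, 1)]) * polyWord (V n) (A n) l)) atTop (𝓝 0) :=
          hx.zero_mul_isBoundedUnder_le ⟨B, Filter.eventually_map.2 (.of_forall hB)⟩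
        have hfx : f x.2 = true := decide_eq_true hx
        refine (by simpa using h2.add h3 : Tendsto _ atTop (𝓝 (0 : ℂ))).congr fun n => ?_
        -- The polynomial is its expansion in centered words plus its trace. The first part is
        -- covered by induction; the second is a null sequence times a bounded one.
        have e : x.2.eval (A n) = ∑ w ∈ W, x.2.coeff w • letterValue (A n) (true, w) +
            tr (x.2.eval (A n)) • 1 := by
          rw [sum_letterValue_true, ← hW]; simp
        rw [polyWord_cons]
        conv_rhs => rw [e]
        simp only [hfx, signatureWord_append_singleton, letterValue_false, map_one, mul_one,
          Finset.mul_sum, Finset.sum_mul, mul_add, add_mul, tr_add, tr_sum, mul_smul_comm,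
          smul_mul_assoc, tr_smul, mul_assoc]
      · have hfx : f x.2 = false := decide_eq_false hx
        refine h2.congr fun n => ?_
        simp only [hfx, polyWord_cons, hW, signatureWord_append_singleton, letterValue_false,
          Finset.mul_sum, Finset.sum_mul, tr_sum, mul_smul_comm, smul_mul_assoc, tr_smul, mul_assoc]
  have := key l [] (fun h => absurd h hne) (by
    rw [List.map_nil, List.nil_append, List.isChain_map]
    exact hl.imp fun x y h hxy => decide_eq_true (h hxy))
  simpa [signatureWord] using this

lemma exists_norm_tr_signatureWord_le (hV : ∀ n, V n ∈ Matrix.unitaryGroup (Fin n) ℂ)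
    (hA : ∀ k, ∃ B, ∀ n, schattenPow k (A n) ≤ B) (s : List (Bool × Bool × FreeMonoid Bool)) :
    ∃ B, ∀ n, ‖tr (signatureWord (V n) (A n) s)‖ ≤ B := by
  obtain ⟨K, hK⟩ := exists_traceBounded_letterValue s (m := 2 * s.length + 1) (by positivity)
  choose B hB using hA
  obtain ⟨c, hc⟩ := hK (1 + ∑ k ∈ Finset.range (K + 1), |B k|) (by
    have := Finset.sum_nonneg fun k (_ : k ∈ Finset.range (K + 1)) => abs_nonneg (B k)
    linarith)
  refine ⟨c, fun n => ?_⟩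
  obtain ⟨T, h1, -, h3, h4⟩ := hc n (A n) fun k hk => by
    have := Finset.single_le_sum (f := fun k => |B k|) (fun _ _ => abs_nonneg _)
      (Finset.mem_range.2 (Nat.lt_succ_of_le hk))
    have h3 := hB k n
    have h4 := le_abs_self (B k)
    linarith
  exact h3.norm_tr_le ((isProdOfLe_word h1 (hV n) h4).mono (by simp))

end Fixed

/-- Sequences of random matrices of growing size. -/
abbrev MatrixSeq (Ω : Type*) : Type _ := (n : ℕ) → Ω → Matrix (Fin n) (Fin n) ℂ

/-! ### Deterministic limits of traces on an event -/

section Limits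

variable {Ω : Type*} {S : Set Ω}

/-- On the event `S`, the normalized traces converge to the constant `c`. -/
def TraceTendsto (S : Set Ω) (b : MatrixSeq Ω) (c : ℂ) : Prop :=
  ∀ ω ∈ S, Tendsto (fun n => tr (b n ω)) atTop (𝓝 c)

lemma TraceTendsto.add {b b' : MatrixSeq Ω} {c c' : ℂ} (h : TraceTendsto S b c)
    (h' : TraceTendsto S b' c') : TraceTendsto S (b + b') (c + c') := fun ω hω =>
  ((h ω hω).add (h' ω hω)).congr fun _ => (tr_add _ _).symm

lemma TraceTendsto.smul {b : MatrixSeq Ω} {c : ℂ} (z : ℂ) (h : TraceTendsto S b c) :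
    TraceTendsto S (z • b) (z * c) := fun ω hω =>
  ((h ω hω).const_mul z).congr fun _ => (tr_smul _ _).symm

lemma traceTendsto_zero : TraceTendsto S (0 : MatrixSeq Ω) 0 := fun _ _ =>
  tendsto_const_nhds.congr fun _ => tr_zero.symm

lemma traceTendsto_one : TraceTendsto S (1 : MatrixSeq Ω) 1 := fun _ _ =>
  tendsto_const_nhds.congr' ((eventually_ne_atTop 0).mono fun _ hn => (tr_one hn).symm)

lemma TraceTendsto.sub_smul_one {b : MatrixSeq Ω} {c : ℂ} (h : TraceTendsto S b c) :
    TraceTendsto S (b - c • 1) 0 := by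
  have := h.add (traceTendsto_one.smul (-c))
  rwa [neg_smul, ← sub_eq_add_neg, mul_one, add_neg_cancel] at this

lemma TraceTendsto.unique (hS : S.Nonempty) {b : MatrixSeq Ω} {c c' : ℂ} (h : TraceTendsto S b c)
    (h' : TraceTendsto S b c') : c = c' :=
  let ⟨ω, hω⟩ := hS
  tendsto_nhds_unique (h ω hω) (h' ω hω)

lemma traceTendsto_of_mem_span {s : Set (MatrixSeq Ω)} (hs : ∀ b ∈ s, TraceTendsto S b 0)
    {b : MatrixSeq Ω} (hb : b ∈ Submodule.span ℂ s) : TraceTendsto S b 0 := by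
  induction hb using Submodule.span_induction with
  | mem b h => exact hs b h
  | zero => exact traceTendsto_zero
  | add b b' _ _ h h' => simpa using h.add h'
  | smul z b _ h => simpa using h.smul z

lemma exists_traceTendsto_of_mem_span {s : Set (MatrixSeq Ω)}
    (hs : ∀ b ∈ s, ∃ c, TraceTendsto S b c) {b : MatrixSeq Ω} (hb : b ∈ Submodule.span ℂ s) :
    ∃ c, TraceTendsto S b c := by
  induction hb using Submodule.span_induction with
  | mem b h => exact hs b h
  | zero => exact ⟨0, traceTendsto_zero⟩
  | add b b' _ _ h h' =>
    obtain ⟨c, h⟩ := h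
    obtain ⟨c', h'⟩ := h'
    exact ⟨_, h.add h'⟩
  | smul z b _ h =>
    obtain ⟨c, h⟩ := h
    exact ⟨_, h.smul z⟩

end Limits

/-! ### Normal forms and alternating products of centered elements -/

section Freeness

variable {Ω : Type*} (S : Set Ω) (U : (n : ℕ) → Ω → Matrix.unitaryGroup (Fin n) ℂ)
  (R : MatrixSeq Ω)

/-- The values of polynomials in `R` and its adjoint. -/
noncomputable def evalSeq : StarPolynomial →ₐ[ℂ] MatrixSeq Ω :=
  FreeAlgebra.lift ℂ fun b n ω => withAdjoint (R n ω) b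

/-- The sequence `U` or its adjoint. -/
noncomputable def unitarySeq (e : Bool) : MatrixSeq Ω :=
  fun n ω => withAdjoint (U n ω : Matrix (Fin n) (Fin n) ℂ) e

/-- The sequence of words in `U` and the values of polynomials at `R` and its adjoint. -/
noncomputable def wordSeq (l : List (Bool × StarPolynomial)) : MatrixSeq Ω :=
  fun n ω => polyWord (U n ω : Matrix (Fin n) (Fin n) ℂ) (R n ω) l

/-- Where the exponent changes its sign, the polynomial is asymptotically centered. -/
def IsCenteredWord (l : List (Bool × StarPolynomial)) : Prop :=
  l.IsChain fun x y => x.1 ≠ y.1 → TraceTendsto S (evalSeq R x.2) 0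

variable {S U R}

lemma lift_seq_apply {J : Type*} (X : J → MatrixSeq Ω) (p : FreeAlgebra ℂ J) (n : ℕ) (ω : Ω) :
    FreeAlgebra.lift ℂ X p n ω = FreeAlgebra.lift ℂ (fun j => X j n ω) p := by
  have : ((Pi.evalAlgHom ℂ (fun _ : Ω => Matrix (Fin n) (Fin n) ℂ) ω).comp
      (Pi.evalAlgHom ℂ (fun n : ℕ => Ω → Matrix (Fin n) (Fin n) ℂ) n)).comp
      (FreeAlgebra.lift ℂ X) = FreeAlgebra.lift ℂ (fun j => X j n ω) := by
    ext j : 2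
    simp
  exact DFunLike.congr_fun this p

lemma evalSeq_apply (q : StarPolynomial) (n : ℕ) (ω : Ω) : evalSeq R q n ω = q.eval (R n ω) :=
  lift_seq_apply _ q n ω

lemma wordSeq_nil : wordSeq U R [] = 1 := rfl

lemma wordSeq_cons (x : Bool × StarPolynomial) (l : List (Bool × StarPolynomial)) :
    wordSeq U R (x :: l) = unitarySeq U x.1 * evalSeq R x.2 * wordSeq U R l := by
  funext n ω
  simp [wordSeq, polyWord_cons, unitarySeq, evalSeq_apply]

lemma wordSeq_append (l l' : List (Bool × StarPolynomial)) :
    wordSeq U R (l ++ l') = wordSeq U R l * wordSeq U R l' := by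
  induction l with
  | nil => simp [wordSeq_nil]
  | cons x l ih => rw [List.cons_append, wordSeq_cons, wordSeq_cons, ih, mul_assoc _ (wordSeq U R l)]

lemma unitarySeq_mul_of_ne {e e' : Bool} (h : e ≠ e') : unitarySeq U e * unitarySeq U e' = 1 := by
  funext n ω
  have h1 : (U n ω : Matrix (Fin n) (Fin n) ℂ) * (U n ω : Matrix (Fin n) (Fin n) ℂ)ᴴ = 1 :=
    Matrix.mem_unitaryGroup_iff.1 (U n ω).2
  have h2 : (U n ω : Matrix (Fin n) (Fin n) ℂ)ᴴ * (U n ω : Matrix (Fin n) (Fin n) ℂ) = 1 :=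
    Matrix.mem_unitaryGroup_iff'.1 (U n ω).2
  cases e <;> cases e' <;> simp_all [unitarySeq]

/-- The basic hypothesis for asymptotic freeness: traces of centered words vanish in the limit. -/
def CenteredWordsVanish (S : Set Ω) (U : (n : ℕ) → Ω → Matrix.unitaryGroup (Fin n) ℂ)
    (R : MatrixSeq Ω) : Prop :=
  ∀ l, l ≠ [] → IsCenteredWord S R l → TraceTendsto S (wordSeq U R l) 0

variable {Q : Subalgebra ℂ StarPolynomial}

variable (S U R Q) in
/-- The words in normal form. -/
def normalForms : Set (MatrixSeq Ω) :=
  {b | ∃ r ∈ Q, ∃ l : List (Bool × StarPolynomial), (∀ x ∈ l, x.2 ∈ Q) ∧ IsCenteredWord S R l ∧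
    b = evalSeq R r * wordSeq U R l}

/-- By cyclicity `r` moves into the last letter of the word, where no centering is required. -/
lemma traceTendsto_evalSeq_mul_wordSeq (hF : CenteredWordsVanish S U R) (r : StarPolynomial)
    {l : List (Bool × StarPolynomial)} (hne : l ≠ []) (hl : IsCenteredWord S R l) :
    TraceTendsto S (evalSeq R r * wordSeq U R l) 0 := by
  rcases List.eq_nil_or_concat l with rfl | ⟨l, x, rfl⟩
  · exact absurd rfl hne
  · rw [List.concat_eq_append] at hl ⊢
    have h : TraceTendsto S (wordSeq U R (l ++ [(x.1, x.2 * r)])) 0 := by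
      refine hF _ (by simp) ?_
      rw [IsCenteredWord, List.isChain_append] at hl ⊢
      refine ⟨hl.1, by simp, fun y hy z hz => ?_⟩
      simp at hz
      subst hz
      exact hl.2.2 y hy x (by simp)
    refine fun ω hω => (h ω hω).congr fun n => ?_
    rw [wordSeq_append, wordSeq_append, wordSeq_cons, wordSeq_cons, map_mul]
    simp only [wordSeq_nil, mul_one, Pi.mul_apply]
    rw [tr_mul_comm (evalSeq R r n ω)]
    simp only [mul_assoc]

lemma exists_traceTendsto_of_mem_normalForms (hF : CenteredWordsVanish S U R)
    (hQ : ∀ q ∈ Q, ∃ c, TraceTendsto S (evalSeq R q) c) {b : MatrixSeq Ω}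
    (hb : b ∈ normalForms S U R Q) : ∃ c, TraceTendsto S b c := by
  obtain ⟨r, hr, l, -, hl', rfl⟩ := hb
  rcases eq_or_ne l [] with rfl | hne
  · simpa [wordSeq_nil] using hQ r hr
  · exact ⟨0, traceTendsto_evalSeq_mul_wordSeq hF r hne hl'⟩

lemma mul_mem_span_of_forall {s t : Set (MatrixSeq Ω)} {a : MatrixSeq Ω}
    (h : ∀ b ∈ s, a * b ∈ Submodule.span ℂ t) {b : MatrixSeq Ω} (hb : b ∈ Submodule.span ℂ s) :
    a * b ∈ Submodule.span ℂ t := by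
  induction hb using Submodule.span_induction with
  | mem b hb => exact h b hb
  | zero => rw [mul_zero]; exact zero_mem _
  | add b b' _ _ h h' => rw [mul_add]; exact add_mem h h'
  | smul z b _ h => rw [mul_smul_comm]; exact Submodule.smul_mem _ _ h

lemma evalSeq_mul_mem_span_normalForms {r : StarPolynomial} (hr : r ∈ Q) {b : MatrixSeq Ω}
    (hb : b ∈ Submodule.span ℂ (normalForms S U R Q)) :
    evalSeq R r * b ∈ Submodule.span ℂ (normalForms S U R Q) := by
  refine mul_mem_span_of_forall ?_ hb
  rintro _ ⟨r', hr', l, hl, hl', rfl⟩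
  exact Submodule.subset_span ⟨r * r', mul_mem hr hr', l, hl, hl', by rw [map_mul, mul_assoc]⟩

/-- If the new exponent differs from the first one in the word, write `r = (r - c) + c` with `c` the
limiting trace. The first summand gives a centered word; in the second the two unitaries cancel and
the word gets shorter. -/
lemma unitarySeq_mul_mem_span_normalForms (hQ : ∀ q ∈ Q, ∃ c, TraceTendsto S (evalSeq R q) c)
    (e : Bool) {b : MatrixSeq Ω} (hb : b ∈ Submodule.span ℂ (normalForms S U R Q)) :
    unitarySeq U e * b ∈ Submodule.span ℂ (normalForms S U R Q) := by
  refine mul_mem_span_of_forall ?_ hb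
  rintro _ ⟨r, hr, l, hl, hl', rfl⟩
  have hcons (r : StarPolynomial) (hr : r ∈ Q) (h : IsCenteredWord S R ((e, r) :: l)) :
      unitarySeq U e * (evalSeq R r * wordSeq U R l) ∈
        Submodule.span ℂ (normalForms S U R Q) := by
    refine Submodule.subset_span ⟨1, one_mem _, (e, r) :: l, ?_, h, ?_⟩
    · intro x hx
      rcases List.mem_cons.1 hx with rfl | hx
      exacts [hr, hl x hx]
    · rw [map_one, one_mul, wordSeq_cons, mul_assoc]
  rcases l with _ | ⟨⟨e', p⟩, l⟩
  · exact hcons r hr (.singleton _)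
  · rcases eq_or_ne e e' with rfl | hee
    · exact hcons r hr (List.isChain_cons_cons.2 ⟨fun h => absurd rfl h, hl'⟩)
    · obtain ⟨c, hc⟩ := hQ r hr
      have h0 : TraceTendsto S (evalSeq R (r - c • 1)) 0 := by
        simpa using hc.sub_smul_one
      have h1 := hcons (r - c • 1) (sub_mem hr (Subalgebra.smul_mem _ (one_mem _) c))
        (List.isChain_cons_cons.2 ⟨fun _ => h0, hl'⟩)
      have h2 : evalSeq R p * wordSeq U R l ∈ Submodule.span ℂ (normalForms S U R Q) :=
        Submodule.subset_span ⟨p, hl (e', p) (by simp), l, fun x hx => hl x (by simp [hx]),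
          hl'.tail, rfl⟩
      have e3 : unitarySeq U e * (evalSeq R r * wordSeq U R ((e', p) :: l)) =
          unitarySeq U e * (evalSeq R (r - c • 1) * wordSeq U R ((e', p) :: l)) +
            c • (evalSeq R p * wordSeq U R l) := by
        have : evalSeq R p * wordSeq U R l =
            unitarySeq U e * wordSeq U R ((e', p) :: l) := by
          rw [wordSeq_cons, ← mul_assoc, ← mul_assoc, unitarySeq_mul_of_ne hee, one_mul]
        rw [this, map_sub, map_smul, map_one, sub_mul, mul_sub, smul_mul_assoc, one_mul,
          mul_smul_comm, sub_add_cancel]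
      rw [e3]
      exact add_mem h1 (Submodule.smul_mem _ c h2)

/-- The word that represents `U ^ m * r`. -/
noncomputable def polyPowWord (m : ℤ) (r : StarPolynomial) : List (Bool × StarPolynomial) :=
  List.replicate (m.natAbs - 1) (decide (m < 0), 1) ++ [(decide (m < 0), r)]

/-- The sequence of the powers `U ^ m`, multiplicative in the exponent. -/
noncomputable def unitaryPowHom (U : (n : ℕ) → Ω → Matrix.unitaryGroup (Fin n) ℂ) :
    Multiplicative ℤ →* MatrixSeq Ω where
  toFun m := fun n ω =>
    ((U n ω ^ m.toAdd : Matrix.unitaryGroup (Fin n) ℂ) : Matrix (Fin n) (Fin n) ℂ)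
  map_one' := by funext n ω; simp
  map_mul' m m' := by funext n ω; simp [zpow_add]

lemma wordSeq_polyPowWord {m : ℤ} (hm : m ≠ 0) (r : StarPolynomial) :
    wordSeq U R (polyPowWord m r) = unitaryPowHom U (.ofAdd m) * evalSeq R r := by
  funext n ω
  have h : (polyPowWord m r).map (fun x => (x.1, x.2.eval (R n ω))) =
      powWord m (r.eval (R n ω)) := by
    simp [polyPowWord, powWord, StarPolynomial.eval]
  rw [wordSeq, polyWord, h, word_powWord _ hm]
  simp [unitaryPowHom, evalSeq_apply]

lemma isCenteredWord_polyPowWord_append (m : ℤ) {r : StarPolynomial}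
    {l : List (Bool × StarPolynomial)} (hl : IsCenteredWord S R l)
    (hr : l ≠ [] → TraceTendsto S (evalSeq R r) 0) :
    IsCenteredWord S R (polyPowWord m r ++ l) := by
  rw [polyPowWord, List.append_assoc, IsCenteredWord, List.isChain_append]
  refine ⟨List.isChain_replicate_of_rel _ (by simp), ?_, ?_⟩
  · refine List.isChain_cons.2 ⟨fun q hq _ => hr ?_, hl⟩
    rintro rfl
    simp at hq
  · intro p hp q hq hpq
    rw [List.eq_of_mem_replicate (List.mem_of_mem_getLast? hp)] at hpq
    simp at hq
    subst hq
    exact absurd rfl hpq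

lemma polyPowWord_ne_nil (m : ℤ) (r : StarPolynomial) : polyPowWord m r ≠ [] := by
  simp [polyPowWord]

lemma traceTendsto_unitaryPowHom (hF : CenteredWordsVanish S U R) {m : ℤ} (hm : m ≠ 0) :
    TraceTendsto S (unitaryPowHom U (.ofAdd m)) 0 := by
  have h := hF (polyPowWord m 1 ++ []) (by simp [polyPowWord_ne_nil])
    (isCenteredWord_polyPowWord_append m .nil fun h => absurd rfl h)
  simpa [wordSeq_polyPowWord hm] using h

variable (S U R Q) in
/-- The factors of an alternating product of centered elements. -/
def IsCenteredFactor (x : Bool × MatrixSeq Ω) : Prop :=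
  if x.1 then ∃ r, TraceTendsto S (evalSeq R r) 0 ∧ x.2 = evalSeq R r
  else x.2 ∈ Submodule.span ℂ {b | ∃ m : ℤ, m ≠ 0 ∧ b = unitaryPowHom U (.ofAdd m)}

variable (S U R) in
/-- Centered words with a centered polynomial in front, or nonempty centered words. -/
def alternatingForms (e : Bool) : Set (MatrixSeq Ω) :=
  if e then {b | ∃ r, TraceTendsto S (evalSeq R r) 0 ∧ ∃ l, IsCenteredWord S R l ∧
    b = evalSeq R r * wordSeq U R l}
  else {b | ∃ l, l ≠ [] ∧ IsCenteredWord S R l ∧ b = wordSeq U R l}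

/-- Factors are prepended one by one. A power of `U` meets a word only across a centered polynomial
in `R`, so a change of sign there is allowed. -/
lemma prod_mem_span_alternatingForms (L : List (Bool × MatrixSeq Ω)) :
    ∀ x, (∀ y ∈ x :: L, IsCenteredFactor S U R y) →
      (x :: L).IsChain (fun y z => y.1 ≠ z.1) →
      ((x :: L).map Prod.snd).prod ∈ Submodule.span ℂ (alternatingForms S U R x.1) := by
  induction L with
  | nil =>
    rintro ⟨_ | _, b⟩ hL _
    · have hb := hL _ (List.mem_singleton_self _)
      simp only [IsCenteredFactor, Bool.false_eq_true, if_false] at hb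
      simp only [List.map_cons, List.map_nil, List.prod_cons, List.prod_nil, mul_one]
      refine Submodule.span_le.2 ?_ hb
      rintro _ ⟨m, hm, rfl⟩
      refine Submodule.subset_span ⟨polyPowWord m 1 ++ [], by simp [polyPowWord_ne_nil],
        isCenteredWord_polyPowWord_append m .nil fun h => absurd rfl h, ?_⟩
      simp [wordSeq_polyPowWord hm]
    · obtain ⟨r, hr, hb⟩ := hL _ (List.mem_singleton_self _)
      simp only at hb
      simp only [List.map_cons, List.map_nil, List.prod_cons, List.prod_nil, mul_one]
      exact Submodule.subset_span ⟨r, hr, [], .nil, by simpa [wordSeq_nil] using hb⟩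
  | cons y L ih =>
    intro x hL hch
    rw [List.isChain_cons_cons] at hch
    have h := ih y (fun z hz => hL z (by simp [List.mem_cons.1 hz])) hch.2
    rw [List.map_cons, List.prod_cons]
    set P := ((y :: L).map Prod.snd).prod
    obtain ⟨e, b⟩ := x
    cases e
    · have hy : y.1 = true := by simpa using hch.1
      rw [hy] at h
      have hb := hL (false, b) (by simp)
      simp only [IsCenteredFactor, Bool.false_eq_true, if_false] at hb
      simp only
      clear hL hch
      induction hb using Submodule.span_induction with
      | zero => rw [zero_mul]; exact zero_mem _
      | add b b' _ _ h h' => rw [add_mul]; exact add_mem h h'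
      | smul z b _ h => rw [smul_mul_assoc]; exact Submodule.smul_mem _ z h
      | mem b hb =>
        obtain ⟨m, hm, rfl⟩ := hb
        refine mul_mem_span_of_forall ?_ h
        rintro _ ⟨r, hr, l, hl, rfl⟩
        refine Submodule.subset_span ⟨polyPowWord m r ++ l, by simp [polyPowWord_ne_nil],
          isCenteredWord_polyPowWord_append m hl fun _ => hr, ?_⟩
        rw [wordSeq_append, wordSeq_polyPowWord hm, mul_assoc]
    · have hy : y.1 = false := by simpa using hch.1
      rw [hy] at h
      obtain ⟨r, hr, hb⟩ := hL (true, b) (by simp)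
      simp only at hb
      subst hb
      refine mul_mem_span_of_forall ?_ h
      rintro _ ⟨l, hne, hl, rfl⟩
      exact Submodule.subset_span ⟨r, hr, l, hl, rfl⟩

lemma traceTendsto_of_mem_span_alternatingForms (hF : CenteredWordsVanish S U R) (e : Bool)
    {b : MatrixSeq Ω} (hb : b ∈ Submodule.span ℂ (alternatingForms S U R e)) :
    TraceTendsto S b 0 := by
  refine traceTendsto_of_mem_span ?_ hb
  cases e
  · rintro _ ⟨l, hne, hl, rfl⟩
    exact hF l hne hl
  · rintro _ ⟨r, hr, l, hl, rfl⟩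
    rcases eq_or_ne l [] with rfl | hne
    · simpa [wordSeq_nil] using hr
    · exact traceTendsto_evalSeq_mul_wordSeq hF r hne hl

end Freeness

/-! ### The joint limit functional and freeness -/

section Joint

variable {Ω : Type*} {S : Set Ω} {U : (n : ℕ) → Ω → Matrix.unitaryGroup (Fin n) ℂ}
  {R : MatrixSeq Ω} {K : Type*} (κ : K → Bool)

variable (U R) in
/-- The joint evaluation of polynomials at `U`, `U*` and the chosen ones among `R`, `R*`. -/
noncomputable def jointEval : FreeAlgebra ℂ (Bool ⊕ K) →ₐ[ℂ] MatrixSeq Ω :=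
  FreeAlgebra.lift ℂ (Sum.elim (unitarySeq U) fun k n ω => withAdjoint (R n ω) (κ k))

/-- The polynomials in the chosen ones among two variables. -/
noncomputable def polySubalgebra : Subalgebra ℂ StarPolynomial :=
  (FreeAlgebra.lift ℂ fun k => FreeAlgebra.ι ℂ (κ k)).range

variable {κ}

lemma evalSeq_lift (p : FreeAlgebra ℂ K) :
    evalSeq R (FreeAlgebra.lift ℂ (fun k => FreeAlgebra.ι ℂ (κ k)) p) =
      FreeAlgebra.lift ℂ (fun k n ω => withAdjoint (R n ω) (κ k)) p := by
  have : (evalSeq R).comp (FreeAlgebra.lift ℂ fun k => FreeAlgebra.ι ℂ (κ k)) =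
      FreeAlgebra.lift ℂ (fun k n ω => withAdjoint (R n ω) (κ k)) := by
    ext k : 2
    simp [evalSeq]
  exact DFunLike.congr_fun this p

lemma exists_traceTendsto_evalSeq {φ : FreeAlgebra ℂ K →ₗ[ℂ] ℂ}
    (hφ : ∀ ω ∈ S, ∀ p, Tendsto (fun n => tr (FreeAlgebra.lift ℂ
      (fun k => withAdjoint (R n ω) (κ k)) p)) atTop (𝓝 (φ p))) :
    ∀ q ∈ polySubalgebra κ, ∃ c, TraceTendsto S (evalSeq R q) c := by
  rintro _ ⟨p, rfl⟩
  refine ⟨φ p, fun ω hω => (hφ ω hω p).congr fun n => ?_⟩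
  rw [← lift_seq_apply (fun k n ω => withAdjoint (R n ω) (κ k)), ← evalSeq_lift]
  rfl

/-- The span of the normal forms is a left module over the joint algebra. Applied to the normal form
`1`, this puts every joint polynomial in the span. The coefficients stay in `polySubalgebra κ`,
since limits are assumed only there. -/
lemma jointEval_mul_mem (hQ : ∀ q ∈ polySubalgebra κ, ∃ c, TraceTendsto S (evalSeq R q) c)
    (p : FreeAlgebra ℂ (Bool ⊕ K)) : ∀ b ∈ Submodule.span ℂ (normalForms S U R (polySubalgebra κ)),
      jointEval U R κ p * b ∈ Submodule.span ℂ (normalForms S U R (polySubalgebra κ)) := by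
  induction p using FreeAlgebra.induction with
  | grade0 z =>
    intro b hb
    rw [AlgHom.commutes, ← Algebra.smul_def]
    exact Submodule.smul_mem _ z hb
  | grade1 x =>
    intro b hb
    rcases x with e | k
    · have : jointEval U R κ (FreeAlgebra.ι ℂ (Sum.inl e)) = unitarySeq U e := by simp [jointEval]
      rw [this]
      exact unitarySeq_mul_mem_span_normalForms hQ e hb
    · have : jointEval U R κ (FreeAlgebra.ι ℂ (Sum.inr k)) =
          evalSeq R (FreeAlgebra.ι ℂ (κ k)) := by simp [jointEval, evalSeq]
      rw [this]
      have hk : FreeAlgebra.ι ℂ (κ k) ∈ polySubalgebra κ := ⟨FreeAlgebra.ι ℂ k, by simp⟩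
      exact evalSeq_mul_mem_span_normalForms hk hb
  | mul p q hp hq =>
    intro b hb
    rw [map_mul, mul_assoc]
    exact hp _ (hq b hb)
  | add p q hp hq =>
    intro b hb
    rw [map_add, add_mul]
    exact add_mem (hp b hb) (hq b hb)

lemma exists_traceTendsto_jointEval (hF : CenteredWordsVanish S U R)
    (hQ : ∀ q ∈ polySubalgebra κ, ∃ c, TraceTendsto S (evalSeq R q) c)
    (p : FreeAlgebra ℂ (Bool ⊕ K)) : ∃ c, TraceTendsto S (jointEval U R κ p) c := by
  have h1 : (1 : MatrixSeq Ω) ∈ Submodule.span ℂ (normalForms S U R (polySubalgebra κ)) :=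
    Submodule.subset_span ⟨1, one_mem _, [], by simp, .nil, by simp [wordSeq_nil]⟩
  have h := jointEval_mul_mem hQ p 1 h1
  rw [mul_one] at h
  exact exists_traceTendsto_of_mem_span
    (fun b hb => exists_traceTendsto_of_mem_normalForms hF hQ hb) h

lemma exists_limitFunctional (hS : S.Nonempty) (hF : CenteredWordsVanish S U R)
    (hQ : ∀ q ∈ polySubalgebra κ, ∃ c, TraceTendsto S (evalSeq R q) c) :
    ∃ φ : FreeAlgebra ℂ (Bool ⊕ K) →ₗ[ℂ] ℂ, ∀ p, TraceTendsto S (jointEval U R κ p) (φ p) := by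
  choose c hc using exists_traceTendsto_jointEval (κ := κ) hF hQ
  exact ⟨{  toFun := c
            map_add' := fun p q => (hc (p + q)).unique hS (by
              rw [map_add]; exact (hc p).add (hc q))
            map_smul' := fun z p => (hc (z • p)).unique hS (by
              rw [map_smul]; exact (hc p).smul z) }, hc⟩

lemma jointEval_mem_of_mem_adjoin_inr {a : FreeAlgebra ℂ (Bool ⊕ K)}
    (ha : a ∈ Algebra.adjoin ℂ (Set.range fun k : K => FreeAlgebra.ι ℂ (Sum.inr k : Bool ⊕ K))) :
    ∃ r, jointEval U R κ a = evalSeq R r := by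
  have : Algebra.adjoin ℂ (Set.range fun k : K => FreeAlgebra.ι ℂ (Sum.inr k : Bool ⊕ K)) ≤
      (evalSeq R).range.comap (jointEval U R κ) := by
    refine Algebra.adjoin_le ?_
    rintro _ ⟨k, rfl⟩
    exact ⟨FreeAlgebra.ι ℂ (κ k), by simp [jointEval, evalSeq]⟩
  obtain ⟨r, hr⟩ := this ha
  exact ⟨r, hr.symm⟩

/-- A polynomial in `U` and `U*` is a Laurent polynomial in `U`. Nonzero powers have vanishing
limiting trace, so the limit is the constant coefficient, which is zero for a centered element. -/
lemma jointEval_mem_of_mem_adjoin_inl (hS : S.Nonempty) (hF : CenteredWordsVanish S U R)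
    {a : FreeAlgebra ℂ (Bool ⊕ K)}
    (ha : a ∈ Algebra.adjoin ℂ (Set.range fun e : Bool => FreeAlgebra.ι ℂ (Sum.inl e : Bool ⊕ K)))
    (h0 : TraceTendsto S (jointEval U R κ a) 0) :
    jointEval U R κ a ∈
      Submodule.span ℂ {b | ∃ m : ℤ, m ≠ 0 ∧ b = unitaryPowHom U (.ofAdd m)} := by
  have h1 : Algebra.adjoin ℂ (Set.range fun e : Bool => FreeAlgebra.ι ℂ (Sum.inl e : Bool ⊕ K)) ≤
      (MonoidAlgebra.lift ℂ (MatrixSeq Ω) (Multiplicative ℤ) (unitaryPowHom U)).range.comap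
        (jointEval U R κ) := by
    refine Algebra.adjoin_le ?_
    rintro _ ⟨e, rfl⟩
    refine ⟨MonoidAlgebra.of ℂ _ (.ofAdd (if e then -1 else 1)), ?_⟩
    simp only [RingHom.coe_coe]
    cases e
    · funext n ω
      simp [unitaryPowHom, jointEval, unitarySeq]
    · funext n ω
      simp [unitaryPowHom, jointEval, unitarySeq]
      rfl
  obtain ⟨f, hf⟩ := h1 ha
  classical
  -- The exponent zero is inserted so that the constant term can be split off even if its
  -- coefficient vanishes.
  set t := insert 1 f.coeff.support
  have h2 : jointEval U R κ a = ∑ m ∈ t, f.coeff m • unitaryPowHom U m := by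
    have hf' : MonoidAlgebra.lift ℂ (MatrixSeq Ω) (Multiplicative ℤ) (unitaryPowHom U) f =
      jointEval U R κ a := hf
    rw [← hf', MonoidAlgebra.lift_apply]
    exact Finsupp.sum_of_support_subset _ (Finset.subset_insert _ _) _ (by simp)
  rw [← Finset.add_sum_erase t _ (Finset.mem_insert_self _ _), map_one (unitaryPowHom U)] at h2
  set b := ∑ m ∈ t.erase 1, f.coeff m • unitaryPowHom U m
  have hb : b ∈ Submodule.span ℂ {b | ∃ m : ℤ, m ≠ 0 ∧ b = unitaryPowHom U (.ofAdd m)} := by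
    refine Submodule.sum_mem _ fun m hm => Submodule.smul_mem _ _ (Submodule.subset_span ?_)
    exact ⟨m.toAdd, fun h => Finset.ne_of_mem_erase hm (Multiplicative.toAdd.injective h), rfl⟩
  have hb0 : TraceTendsto S b 0 := traceTendsto_of_mem_span (by
    rintro _ ⟨m, hm, rfl⟩
    exact traceTendsto_unitaryPowHom hF hm) hb
  have h3 := (traceTendsto_one.smul (f.coeff 1)).add hb0
  rw [← h2, mul_one, add_zero] at h3
  rwa [h2, h3.unique hS h0, zero_smul, zero_add]

lemma isFreeFamily_of_traceTendsto (hS : S.Nonempty) (hF : CenteredWordsVanish S U R)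
    {φ : FreeAlgebra ℂ (Bool ⊕ K) →ₗ[ℂ] ℂ} (hφ : ∀ p, TraceTendsto S (jointEval U R κ p) (φ p)) :
    IsFreeFamily φ (fun b : Bool => Algebra.adjoin ℂ
      (if b then Set.range (fun k : K => FreeAlgebra.ι ℂ (Sum.inr k : Bool ⊕ K))
        else Set.range (fun j : Bool => FreeAlgebra.ι ℂ (Sum.inl j : Bool ⊕ K)))) := by
  intro l i a ha hi ha0
  set L := List.ofFn fun k => (i k, jointEval U R κ (a k)) with hL
  have hfac : ∀ y ∈ L, IsCenteredFactor S U R y := by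
    intro y hy
    obtain ⟨k, rfl⟩ := List.mem_ofFn.1 hy
    have hak := ha k
    have h0 := hφ (a k)
    rw [ha0 k] at h0
    simp only [IsCenteredFactor]
    split_ifs with hk
    · simp only [hk, if_true] at hak
      obtain ⟨r, hr⟩ := jointEval_mem_of_mem_adjoin_inr (U := U) (R := R) (κ := κ) hak
      exact ⟨r, hr ▸ h0, hr⟩
    · simp only [hk] at hak
      exact jointEval_mem_of_mem_adjoin_inl hS hF hak h0
  have hch : L.IsChain fun y z => y.1 ≠ z.1 := by
    rw [hL, List.isChain_ofFn]
    intro k hk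
    exact hi ⟨k, by omega⟩
  have hprod : jointEval U R κ (List.ofFn a).prod = (L.map Prod.snd).prod := by
    rw [map_list_prod, hL, List.map_ofFn, List.map_ofFn]
    rfl
  refine (hφ _).unique hS ?_
  rw [hprod]
  rw [hL, List.ofFn_succ] at hfac hch ⊢
  exact traceTendsto_of_mem_span_alternatingForms hF _ (prod_mem_span_alternatingForms _ _ hfac hch)

end Joint

/-! ### Assembly -/

section Main

variable {Ω : Type*} [MeasurableSpace Ω] {μ : Measure Ω}

instance : Countable (FreeMonoid Bool) := inferInstanceAs (Countable (List Bool))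

variable [IsProbabilityMeasure μ]
    {U : (n : ℕ) → Ω → Matrix.unitaryGroup (Fin n) ℂ}
    {R : (n : ℕ) → Ω → Matrix (Fin n) (Fin n) ℂ}

lemma ae_forall_tendsto_tr_signatureWord
    (hU : ∀ n, IsStandardUnitary μ (U n)) (hR : ∀ n, Measurable (R n))
    (hUR : ∀ n, IndepFun (U n) (R n) μ)
    (hbdd : ∀ᵐ ω ∂μ, ∀ k, ∃ B, ∀ n, schattenPow k (R n ω) ≤ B) :
    ∀ᵐ ω ∂μ, ∀ s, s ≠ [] → IsCenteredSignature s → Tendsto (fun n =>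
      tr (signatureWord (U n ω : Matrix (Fin n) (Fin n) ℂ) (R n ω) s)) atTop (𝓝 0) :=
  ae_all_iff.2 fun _ => ae_all_iff.2 fun hne => ae_all_iff.2 fun hs =>
    ae_tendsto_tr_signatureWord hU hR hUR hbdd hne hs

/-- All almost sure properties are collected in one event `S` of full measure, on which the argument
is deterministic. The map `κ` selects which of `R`, `R*` occur, so both freeness claims are
instances. -/
lemma asymptoticallyFree_of_ae
    (h1 : ∀ᵐ ω ∂μ, ∀ s, s ≠ [] → IsCenteredSignature s → Tendsto (fun n =>
      tr (signatureWord (U n ω : Matrix (Fin n) (Fin n) ℂ) (R n ω) s)) atTop (𝓝 0))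
    (h2 : ∀ᵐ ω ∂μ, ∀ k, ∃ B, ∀ n, schattenPow k (R n ω) ≤ B) {K : Type*} (κ : K → Bool)
    (h3 : ∃ φ, HasLimitDistribution μ (fun n k ω => withAdjoint (R n ω) (κ k)) φ) :
    AsymptoticallyFree μ (fun n b ω => withAdjoint (U n ω : Matrix (Fin n) (Fin n) ℂ) b)
      (fun n k ω => withAdjoint (R n ω) (κ k)) := by
  obtain ⟨φR, hφR⟩ := h3
  set S : Set Ω := {ω | (∀ s, s ≠ [] → IsCenteredSignature s → Tendsto (fun n =>
      tr (signatureWord (U n ω : Matrix (Fin n) (Fin n) ℂ) (R n ω) s)) atTop (𝓝 0)) ∧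
    (∀ k, ∃ B, ∀ n, schattenPow k (R n ω) ≤ B) ∧
    ∀ p : FreeAlgebra ℂ K, Tendsto (fun n => tr (FreeAlgebra.lift ℂ
      (fun k => withAdjoint (R n ω) (κ k)) p)) atTop (𝓝 (φR p))}
  have hSae : ∀ᵐ ω ∂μ, ω ∈ S := by
    filter_upwards [h1, h2, hφR] with ω a b c using ⟨a, b, c⟩
  -- A single realization in `S` suffices to make the limits unique, hence the limit functional
  -- linear.
  have hS : S.Nonempty := hSae.exists
  have hF : CenteredWordsVanish S U R := by
    intro l hne hl ω hω
    refine tendsto_tr_polyWord hω.1 (exists_norm_tr_signatureWord_le (fun n => (U n ω).2) hω.2.1)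
      hne (hl.imp fun x y h hxy => ?_)
    simpa only [evalSeq_apply] using h hxy ω hω
  have hQ := exists_traceTendsto_evalSeq (S := S) (R := R) (κ := κ) (φ := φR)
    fun ω hω => hω.2.2
  obtain ⟨φ, hφ⟩ := exists_limitFunctional hS hF hQ
  refine ⟨φ, ?_, isFreeFamily_of_traceTendsto hS hF hφ⟩
  filter_upwards [hSae] with ω hω p
  refine (hφ p ω hω).congr fun n => ?_
  rw [jointEval, lift_seq_apply]
  congr 2
  congr 1
  funext x
  cases x <;> rfl

end Main

end RandomMatrix

theorem theorem3p2 {Ω : Type*} [MeasurableSpace Ω] (μ : Measure Ω) [IsProbabilityMeasure μ]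
    (U : (n : ℕ) → Ω → Matrix.unitaryGroup (Fin n) ℂ)
    (R : (n : ℕ) → Ω → Matrix (Fin n) (Fin n) ℂ)
    (hU : ∀ n, IsStandardUnitary μ (U n))
    (hR : ∀ n, Measurable (R n))
    (hUR : ∀ n, IndepFun (U n) (R n) μ)
    (ρ : Measure ℝ) [IsProbabilityMeasure ρ] (hρ : ∃ K : Set ℝ, IsCompact K ∧ ρ Kᶜ = 0)
    (hconv : ∀ᵐ ω ∂μ, ConvergesInDistribution
      (fun n => empiricalEigenvalueDistribution
        (Matrix.isHermitian_mul_conjTranspose_self (R n ω))) ρ) :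
    -- ordinary polynomials, uniformly for bounded degrees and coefficients
    (∀ᵐ ω ∂μ, ∀ (l : ℕ) (m : Fin l → ℤ), 0 < l → (∀ i, m i ≠ 0) →
      ∀ (d : ℕ) (C ε : ℝ), 0 < ε → ∀ᶠ n in atTop, ∀ P : Fin l → Polynomial ℂ,
        (∀ i, (P i).natDegree ≤ d) → (∀ i k, ‖(P i).coeff k‖ ≤ C) →
        (∀ i, tr (Polynomial.aeval (R n ω) (P i)) = 0) →
        ‖tr (alternatingProduct (U n ω) m (fun i => Polynomial.aeval (R n ω) (P i)))‖ < ε) ∧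
    -- noncommutative polynomials in the matrix and its adjoint, likewise
    (∀ᵐ ω ∂μ, ∀ (l : ℕ) (m : Fin l → ℤ), 0 < l → (∀ i, m i ≠ 0) →
      ∀ (d : ℕ) (C ε : ℝ), 0 < ε → ∀ᶠ n in atTop, ∀ P : Fin l → StarPolynomial,
        (∀ i (w : FreeMonoid Bool), d < w.length → (P i).coeff w = 0) →
        (∀ i w, ‖(P i).coeff w‖ ≤ C) →
        (∀ i, tr ((P i).eval (R n ω)) = 0) →
        ‖tr (alternatingProduct (U n ω) m (fun i => (P i).eval (R n ω)))‖ < ε) ∧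
    -- asymptotic freeness, if the matrices have a limit distribution
    ((∃ φ, HasLimitDistribution μ (fun n (_ : Unit) ω => R n ω) φ) →
      AsymptoticallyFree μ
        (fun n b ω => withAdjoint (U n ω : Matrix (Fin n) (Fin n) ℂ) b)
        (fun n (_ : Unit) ω => R n ω)) ∧
    -- the same with adjoints
    ((∃ φ, HasLimitDistribution μ (fun n b ω => withAdjoint (R n ω) b) φ) →
      AsymptoticallyFree μ
        (fun n b ω => withAdjoint (U n ω : Matrix (Fin n) (Fin n) ℂ) b)
        (fun n b ω => withAdjoint (R n ω) b)) := by
  have hbdd := ae_schattenPow_bdd hconv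
  have hsig := ae_forall_tendsto_tr_signatureWord hU hR hUR hbdd
  refine ⟨?_, ?_, fun h => asymptoticallyFree_of_ae hsig hbdd (fun _ => false) h,
    fun h => asymptoticallyFree_of_ae hsig hbdd id h⟩
  · filter_upwards [hsig] with ω hω l m hl hm d C ε hε
    have hW : 1 ∈ (Finset.range (d + 1)).map ⟨fun k => FreeMonoid.of false ^ k, fun j k h => by
        simpa [length_of_pow] using congrArg FreeMonoid.length h⟩ :=
      Finset.mem_map.2 ⟨0, by simp, rfl⟩
    filter_upwards [eventually_norm_tr_alternatingProduct_lt hω hW C hl hm hε] with n hn P h1 h2 h3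
    exact hn _ (fun i => isBoundedComb_aeval _ (h1 i) (h2 i)) h3
  · filter_upwards [hsig] with ω hω l m hl hm d C ε hε
    obtain ⟨W, hW⟩ := exists_finset_words d
    have h1W : 1 ∈ W := (hW 1).2 (Nat.zero_le d)
    filter_upwards [eventually_norm_tr_alternatingProduct_lt hω h1W C hl hm hε] with n hn P h1 h2 h3
    refine hn _ (fun i => ⟨(P i).coeff, fun w _ => h2 i w, (P i).eval_eq_sum _ fun w hw => ?_⟩) h3
    exact h1 i w (not_le.1 fun h => hw ((hW w).2 h))
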